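/- **Game.** A state $\theta\in\{H,L\}$ is drawn once, with $\mathbb P(\theta=H)=p_0\in(0,1)$. In each period $t=1,2,\dots$ each of two players $i$ observes a private signal $x_{it}$ in a finite set $X$, then chooses $a_{it}\in\{I,N\}$; actions are publicly observed, payoffs are not. Given $\theta$, signals are independent across players and periods with law $f_\theta$, where $f_H\ne f_L$ and $f_\theta(x)>0$ for all $\theta,x$. The stage payoff $u_i(a,\theta)$ is $0$ if $a_i=N$, $1-c$ if $a=(I,I)$ and $\theta=H$, and $-c$ otherwise. Long-run payoffs are $\mathbb E_\sigma\bigl[\sum_{t\ge1}(1-\delta)\delta^{t-1}u_i(a_t,\theta)\bigr]$. A pure strategy $s_i$ maps each private history $(a^{t-1},x_i^t)$ to an action. The set of pure strategies carries the product topology, and a mixed strategy $\sigma_i$ is a Borel probability measure on it. **Cool-off scheme.** A function $T:\mathbb N\to\mathbb N$ splits action histories into cool-off histories $\mathcal C$ and investment histories $\mathcal I$. The empty history is in $\mathcal C$. For $t\ge1$: if $a^{t-1}\in\mathcal I$, then $a^t\in\mathcal I$ iff $a_t=(I,I)$. If $a^{t-1}\in\mathcal C$ and $a^{s-1}$ is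 the longest initial segment of $a^{t}$ in $\mathcal I$, then $a^t\in\mathcal I$ iff $t>s+T(s)-1$. If $a^{t-1}\in\mathcal C$ and no initial segment of $a^{t-1}$ is in $\mathcal I$, then $a^t\in\mathcal I$ iff $t>T(1)$. **Restricted strategies.** $S_i(T)$ is the set of pure strategies that choose $N$ at every $(a^{t-1},x_i^t)$ such that $a^{t-1}\in\mathcal C$, or such that some player chose $I$ in some period $\tau<t$ with $a^{\tau-1}\in\mathcal C$ (a *cool-off violation*). A private history $(a^{t-1},x_i^t)$ is consistent with $s_i$ if $s_i(a^{\tau-1},x_i^\tau)=a_{i\tau}$ for all $\tau<t$. It is consistent with $\sigma_i$ if it is consistent with some $s_i$ in the support of $\sigma_i$; and $a^{t-1}$ is consistent with $\sigma_i$ if $(a^{t-1},x_i^t)$ is, for some $x_i^t$. Let $\sigma_i(a^{t-1},x_i^t)(b)$ be the $\sigma_i$-probability that $s_i(a^{t-1},x_i^t)=b$, conditional on $s_i$ being consistent with $(a^{t-1},x_i^t)$, and put $$\sigma_i(a^{t-1})(I\mid H)=\frac{\sum_{x_i^t}f_H(x_i^t)\prod_{\tau<t}\sigma_i(a^{\tau-1},x_i^\tau)(a_{i\tau})\,\sigma_i(a^{t-1},x_i^t)(I)}{\sum_{x_i^t}f_H(x_i^t)\prod_{\tau<t}\sigma_i(a^{\tau-1},x_i^\tau)(a_{i\tau})},\qquad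 f_H(x_i^t)=\prod_{\tau\le t}f_H(x_{i\tau}).$$ $\Sigma_i(T,\varepsilon)$ is the set of mixed strategies $\sigma_i$ whose support is contained in $S_i(T)$ and that satisfy $\sigma_i(a^{t-1})(I\mid H)\ge1-\varepsilon$ at every $a^{t-1}\in\mathcal I$ that is consistent with $\sigma_i$ and contains no cool-off violation. A restricted equilibrium is a profile $\sigma\in\Sigma_1(T,\varepsilon)\times\Sigma_2(T,\varepsilon)$ such that no player $i$ can increase his long-run expected payoff by deviating to another strategy in $\Sigma_i(T,\varepsilon)$. (Every Nash equilibrium of the unrestricted game that lies in $\Sigma_1(T,\varepsilon)\times\Sigma_2(T,\varepsilon)$ is one.) **Proposition.** Let $p_0,X,f_H,f_L$ be as above, let $c,\delta\in(0,1)$, and let $T_0\in\mathbb N$ and $\varepsilon>0$ satisfy $$\delta^{T_0}<(1-\delta)(1-c-\varepsilon).$$ Then there is a function $T:\mathbb N\to\mathbb N$ with $T(t)\ge T_0$ for all $t\ge2$ such that, for every restricted equilibrium $\sigma\in\Sigma_1(T,\varepsilon)\times\Sigma_2(T,\varepsilon)$, every action history $a^{t-1}\in\mathcal I$ that has positive probability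 under $\sigma$, and each $i=1,2$, $$\mathbb E_\sigma\bigl[p_{it}\mid\theta=H,\,a^{t-1}\bigr]>1-\varepsilon^2,$$ where $p_{it}=\mathbb P_\sigma[\theta=H\mid a^{t-1},x_i^t]$ is player $i$'s private belief in period $t$. -/

import Mathlib

open MeasureTheory ProbabilityTheory

noncomputable section

namespace CoolOff

/-- The two states of nature. -/
inductive State where
  | H
  | L

/-- The two stage-game actions: `I` (invest) and `N` (not invest). -/
inductive Act where
  | I
  | N

instance : MeasurableSpace State := ⊤
instance : DiscreteMeasurableSpace State := ⟨fun _ => trivial⟩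

instance : Finite Act :=
  Finite.of_injective (fun a : Act => (match a with | .I => true | .N => false : Bool))
    (by intro a b h; cases a <;> cases b <;> simp_all)
instance : TopologicalSpace Act := ⊥
instance : DiscreteTopology Act := ⟨rfl⟩
instance : MeasurableSpace Act := ⊤
instance : DiscreteMeasurableSpace Act := ⟨fun _ => trivial⟩

/-- Act profiles; the two players are the elements of `Fin 2`. -/
abbrev Profile := Fin 2 → Act

/-- The profile in which both players invest. -/
def bothInvest : Profile := fun _ => Act.I

/-- Act histories `a^n = (a_1, …, a_n)`; the entry `a k` is the profile played in
period `k + 1`. -/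
abbrev ActionHistory (n : ℕ) := Fin n → Profile

/-- Private histories `(a^{t-1}, x^t)` of all periods `t = n + 1`, `n ≥ 0`. -/
abbrev PrivateHistory (X : Type*) := Σ n : ℕ, ActionHistory n × (Fin (n + 1) → X)

/-- Pure strategies, with the product topology and the product (= Borel) σ-algebra. -/
abbrev PureStrategy (X : Type*) := PrivateHistory X → Act

/-- Mixed strategies: Borel probability measures on the space of pure strategies. -/
abbrev MixedStrategy (X : Type*) := ProbabilityMeasure (PureStrategy X)

/-! ### The cool-off scheme -/

open Classical in
/-- The length of the longest initial segment (possibly the whole history) of an action history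
that is an investment history; `none` if there is no such segment.
Writing `t = n + 1` for the length of the history in the recursive step:
* if no proper initial segment is an investment history, `a^t` is one iff `t > T 1`;
* if `a^{t-1}` is an investment history, `a^t` is one iff `a_t = (I, I)`;
* if `a^{t-1}` is a cool-off history and `a^{s-1}`, `s = m + 1`, is its longest initial segment that
  is an investment history, `a^t` is an investment history iff `t > s + T s - 1 = m + T (m + 1)`. -/
def lastInvest (T : ℕ → ℕ) : (n : ℕ) → ActionHistory n → Option ℕ
  | 0, _ => none
  | n + 1, a =>
    match lastInvest T n (Fin.init a) with
    | none => if T 1 < n + 1 then some (n + 1) else none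
    | some m =>
      if m = n then
        (if a (Fin.last n) = bothInvest then some (n + 1) else some m)
      else
        (if m + T (m + 1) < n + 1 then some (n + 1) else some m)

/-- The investment histories of the cool-off scheme induced by `T`. -/
def IsInvestment (T : ℕ → ℕ) {n : ℕ} (a : ActionHistory n) : Prop :=
  lastInvest T n a = some n

/-- `lastInvest` is indeed the length of the longest initial segment that is an investment
history. -/
theorem lastInvest_spec (T : ℕ → ℕ) : ∀ (n : ℕ) (a : ActionHistory n),
    (∀ m, lastInvest T n a = some m → ∃ h : m ≤ n, IsInvestment T (Fin.take m h a) ∧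
      ∀ k (hk : k ≤ n), m < k → ¬ IsInvestment T (Fin.take k hk a)) ∧
    (lastInvest T n a = none → ∀ k (hk : k ≤ n), ¬ IsInvestment T (Fin.take k hk a)) := by
  intro n
  induction n with
  | zero =>
    intro a
    refine ⟨by intro m h; simp [lastInvest] at h, ?_⟩
    intro _ k hk
    obtain rfl : k = 0 := by omega
    simp [IsInvestment, lastInvest]
  | succ n ih =>
    intro a
    obtain ⟨i1, i2⟩ := ih (Fin.init a)
    have key : lastInvest T (n+1) a = some (n+1) ∨ lastInvest T (n+1) a = lastInvest T n (Fin.init a) := by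
      rw [lastInvest]
      split <;> rename_i h
      · rw [h]; split_ifs <;> simp
      · rw [h]; split_ifs <;> simp
    rcases key with h | h
    · refine ⟨?_, by simp [h]⟩
      intro m hm
      rw [h] at hm
      obtain rfl : n + 1 = m := by simpa using hm
      exact ⟨le_rfl, h, fun k hk hk' => absurd hk (by omega)⟩
    · have hn : ∀ m, lastInvest T (n+1) a = some m → m ≤ n := fun m hm => (i1 m (h ▸ hm)).1
      have nf : ¬ IsInvestment T a := fun hh => absurd (hn _ hh) (by omega)
      constructor
      · intro m hm
        obtain ⟨h1, h2, h3⟩ := i1 m (h ▸ hm)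
        refine ⟨by omega, h2, fun k hk hmk => ?_⟩
        rcases Nat.lt_or_ge n k with hk' | hk'
        · obtain rfl : k = n+1 := by omega
          exact nf
        · exact h3 k hk' hmk
      · intro hm k hk
        rcases Nat.lt_or_ge n k with hk' | hk'
        · obtain rfl : k = n+1 := by omega
          exact nf
        · exact i2 (h ▸ hm) k hk'

/-- The cool-off histories of the cool-off scheme induced by `T`. -/
def IsCoolOff (T : ℕ → ℕ) {n : ℕ} (a : ActionHistory n) : Prop :=
  ¬ IsInvestment T a

/-- Some player chose `I` at some past time at which play was in a cool-off phase. -/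
def CoolOffBreach (T : ℕ → ℕ) {n : ℕ} (a : ActionHistory n) : Prop :=
  ∃ k : Fin n, IsCoolOff T (Fin.take k k.isLt.le a) ∧ ∃ j : Fin 2, a k j = Act.I

/-! ### Strategies -/

section Strategies

variable {X : Type*}

/-- The pure strategies that choose `N` in every cool-off phase, and choose `N` whenever some player
chose `I` during a cool-off phase in the past. -/
def coolOffPure (X : Type*) (T : ℕ → ℕ) : Set (PureStrategy X) :=
  {s | (∀ (n : ℕ) (a : ActionHistory n) (x : Fin (n + 1) → X), IsCoolOff T a →
          s ⟨n, a, x⟩ = Act.N) ∧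
       (∀ (n : ℕ) (a : ActionHistory n) (x : Fin (n + 1) → X), CoolOffBreach T a →
          s ⟨n, a, x⟩ = Act.N)}

/-- The private history `(a, x)` is consistent with player `i` using the pure strategy `s`. -/
def Consistent (i : Fin 2) (s : PureStrategy X) {n : ℕ} (a : ActionHistory n)
    (x : Fin (n + 1) → X) : Prop :=
  ∀ k : Fin n,
    s ⟨k, Fin.take k k.isLt.le a, Fin.take (k + 1) (Nat.succ_le_succ k.isLt.le) x⟩ = a k i

/-- The action history `a` is consistent with the mixed strategy `σ` of player `i`: for some signals
the private history is consistent with some pure strategy in the support of `σ`.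
(Signals have full support, so every signal sequence occurs with positive probability.) -/
def ConsistentMixed (i : Fin 2) (σ : MixedStrategy X) {n : ℕ} (a : ActionHistory n) : Prop :=
  ∃ x : Fin (n + 1) → X, ∃ s ∈ (σ : Measure (PureStrategy X)).support, Consistent i s a x

/-- The conditional probability `σ(a, x)(b)` that `σ` takes action `b` at the private history
`(a, x)`, given that the pure strategy is consistent with `(a, x)`. -/
def behavior (i : Fin 2) (σ : MixedStrategy X) {n : ℕ} (a : ActionHistory n)
    (x : Fin (n + 1) → X) (b : Act) : ℝ :=
  (σ : Measure (PureStrategy X)).real {s | Consistent i s a x ∧ s ⟨n, a, x⟩ = b} /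
    (σ : Measure (PureStrategy X)).real {s | Consistent i s a x}

/-- The weight `∏_{τ < t} σ(a^{τ-1}, x^τ)(a_{iτ})`. -/
def pastWeight (i : Fin 2) (σ : MixedStrategy X) {n : ℕ} (a : ActionHistory n)
    (x : Fin (n + 1) → X) : ℝ :=
  ∏ k : Fin n, behavior i σ (Fin.take k k.isLt.le a)
    (Fin.take (k + 1) (Nat.succ_le_succ k.isLt.le) x) (a k i)

/-- The conditional probability `σ(a)(I | H)` of investing at `a` in the high state. -/
def investProbH [Fintype X] (f : State → PMF X) (i : Fin 2) (σ : MixedStrategy X) {n : ℕ}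
    (a : ActionHistory n) : ℝ :=
  (∑ x : Fin (n + 1) → X,
      (∏ k, (f State.H (x k)).toReal) * (pastWeight i σ a x * behavior i σ a x Act.I)) /
    (∑ x : Fin (n + 1) → X, (∏ k, (f State.H (x k)).toReal) * pastWeight i σ a x)

/-- The cool-off strategies of player `i`: mixed strategies supported in `coolOffPure X T` that, at
every consistent investment history not preceded by an investment during a cool-off phase, invest
with probability at least `1 - ε` conditional on the high state. -/
def coolOffStrategies [Fintype X] (f : State → PMF X) (T : ℕ → ℕ) (ε : ℝ) (i : Fin 2) :
    Set (MixedStrategy X) :=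
  {σ | (σ : Measure (PureStrategy X)).support ⊆ coolOffPure X T ∧
       ∀ (n : ℕ) (a : ActionHistory n), IsInvestment T a → ¬ CoolOffBreach T a →
         ConsistentMixed i σ a → 1 - ε ≤ investProbH f i σ a}

end Strategies

/-! ### Play, payoffs and beliefs -/

section Play

variable {X : Type*}

/-- Outcomes: the state, the signals (`x k i` is player `i`'s signal in period `k + 1`) and the
action profiles (`a k` is the profile of period `k + 1`). -/
abbrev Outcome (X : Type*) := State × (ℕ → Fin 2 → X) × (ℕ → Profile)

/-- The first `n` action profiles when the pure strategies `s` meet the signals `x`. -/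
def playHistory (x : ℕ → Fin 2 → X) (s : Fin 2 → PureStrategy X) : (n : ℕ) → ActionHistory n
  | 0 => Fin.elim0
  | n + 1 => Fin.snoc (α := fun _ => Profile) (playHistory x s n)
      (fun i => s i ⟨n, playHistory x s n, fun k => x k i⟩)

/-- The outcome of the pure strategies `s` in state `θ` with signals `x`. -/
def outcome (θ : State) (z : (ℕ → Fin 2 → X) × (Fin 2 → PureStrategy X)) : Outcome X :=
  (θ, z.1, fun n i => z.2 i ⟨n, playHistory z.1 z.2 n, fun k => z.1 k i⟩)

/-- Player `i`'s private history `(a^n, x_i^{n+1})` in period `n + 1`. -/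
def privateHistory (i : Fin 2) (n : ℕ) (ω : Outcome X) : ActionHistory n × (Fin (n + 1) → X) :=
  (fun k => ω.2.2 k, fun k => ω.2.1 k i)

/-- The event that the state is high. -/
def highState (X : Type*) : Set (Outcome X) := {ω | ω.1 = State.H}

/-- The event that the first `n` action profiles are `a`. -/
def historyEvent (X : Type*) {n : ℕ} (a : ActionHistory n) : Set (Outcome X) :=
  {ω | (fun k : Fin n => ω.2.2 k) = a}

open Classical in
/-- The stage payoff of player `i`. -/
def stagePayoff (c : ℝ) (i : Fin 2) (a : Profile) (θ : State) : ℝ :=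
  if a i = Act.N then 0
  else if a = bothInvest ∧ θ = State.H then 1 - c
  else -c

/-- The discounted payoff `∑_{t ≥ 1} (1 - δ) δ^{t-1} u_i(a_t, θ)`. -/
def discountedPayoff (c δ : ℝ) (i : Fin 2) (ω : Outcome X) : ℝ :=
  ∑' n : ℕ, (1 - δ) * δ ^ n * stagePayoff c i (ω.2.2 n) ω.1

variable [MeasurableSpace X]

theorem measurable_play [Finite X] [DiscreteMeasurableSpace X] : ∀ n, Measurable (fun z : (ℕ → Fin 2 → X) × (Fin 2 → PureStrategy X) =>
       playHistory z.1 z.2 n) ∧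
   ∀ i, Measurable (fun z : (ℕ → Fin 2 → X) × (Fin 2 → PureStrategy X) =>
       z.2 i ⟨n, playHistory z.1 z.2 n, fun k => z.1 k i⟩) := by
  have step : ∀ n, Measurable (fun z : (ℕ → Fin 2 → X) × (Fin 2 → PureStrategy X) =>
       playHistory z.1 z.2 n) →
     ∀ i, Measurable (fun z : (ℕ → Fin 2 → X) × (Fin 2 → PureStrategy X) =>
       z.2 i ⟨n, playHistory z.1 z.2 n, fun k => z.1 k i⟩) := by
    intro n hn i
    have h1 : Measurable (fun z : (ℕ → Fin 2 → X) × (Fin 2 → PureStrategy X) =>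
       ((playHistory z.1 z.2 n, fun k : Fin (n+1) => z.1 k i) :
        ActionHistory n × (Fin (n+1) → X))) := by
      refine hn.prodMk ?_
      fun_prop
    have h2 : Measurable (fun q : (ActionHistory n × (Fin (n+1) → X)) × (Fin 2 → PureStrategy X) =>
        q.2 i ⟨n, q.1⟩) := by
      apply measurable_from_prod_countable_right
      intro x
      dsimp
      fun_prop
    exact h2.comp (h1.prodMk measurable_snd)
  have a : ∀ n, Measurable (fun z : (ℕ → Fin 2 → X) × (Fin 2 → PureStrategy X) =>
       playHistory z.1 z.2 n) := by
    intro n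
    induction n with
    | zero => exact measurable_const
    | succ n ih =>
      refine measurable_pi_iff.2 fun k => ?_
      refine Fin.lastCases ?_ (fun k => ?_) k
      · simp only [playHistory, Fin.snoc_last]
        exact measurable_pi_iff.2 (step n ih)
      · simp only [playHistory, Fin.snoc_castSucc]
        exact (measurable_pi_apply k).comp ih
  exact fun n => ⟨a n, step n (a n)⟩

/-- The outcome map is measurable, so the image measures below are genuine. -/
theorem measurable_outcome [Finite X] [DiscreteMeasurableSpace X] (θ : State) : Measurable (outcome (X := X) θ) := by
  refine measurable_const.prodMk (measurable_fst.prodMk ?_)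
  exact measurable_pi_iff.2 fun n => measurable_pi_iff.2 ((measurable_play n).2)

/-- The joint law of the signals (independent across players and periods, with law `f θ`) and of the
players' independently drawn pure strategies, given the state `θ`. -/
def drawLaw (f : State → PMF X) (σ : Fin 2 → MixedStrategy X) (θ : State) :
    Measure ((ℕ → Fin 2 → X) × (Fin 2 → PureStrategy X)) :=
  (Measure.infinitePi fun _ : ℕ => Measure.pi fun _ : Fin 2 => (f θ).toMeasure).prod
    (Measure.pi fun i => (σ i : Measure (PureStrategy X)))

/-- The law on outcomes induced by the strategy profile `σ`, when `p₀` is the prior probability of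
the high state. -/
def outcomeLaw (p₀ : ℝ) (f : State → PMF X) (σ : Fin 2 → MixedStrategy X) :
    Measure (Outcome X) :=
  ENNReal.ofReal p₀ • (drawLaw f σ State.H).map (outcome State.H) +
    ENNReal.ofReal (1 - p₀) • (drawLaw f σ State.L).map (outcome State.L)

/-- The long-run expected payoff of player `i`. -/
def expectedPayoff (p₀ : ℝ) (f : State → PMF X) (c δ : ℝ) (σ : Fin 2 → MixedStrategy X)
    (i : Fin 2) : ℝ :=
  ∫ ω, discountedPayoff c δ i ω ∂(outcomeLaw p₀ f σ)

/-- The private belief of player `i` in period `n + 1`: the conditional probability of the high state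
given the realized private history. -/
def privateBelief (p₀ : ℝ) (f : State → PMF X) (σ : Fin 2 → MixedStrategy X) (i : Fin 2) (n : ℕ)
    (ω : Outcome X) : ℝ :=
  ((outcomeLaw p₀ f σ)[|{ω' | privateHistory i n ω' = privateHistory i n ω}]).real (highState X)

/-- `E_σ[p_{i,n+1} | θ = H, a^n = a]`. -/
def expectedBeliefH (p₀ : ℝ) (f : State → PMF X) (σ : Fin 2 → MixedStrategy X) (i : Fin 2) {n : ℕ}
    (a : ActionHistory n) : ℝ :=
  ∫ ω, privateBelief p₀ f σ i n ω ∂((outcomeLaw p₀ f σ)[|highState X ∩ historyEvent X a])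

/-- Nash equilibria of the game in which each player `i` is restricted to
`coolOffStrategies f T ε i`. -/
def IsRestrictedEquilibrium [Fintype X] (p₀ : ℝ) (f : State → PMF X) (c δ : ℝ) (T : ℕ → ℕ) (ε : ℝ)
    (σ : Fin 2 → MixedStrategy X) : Prop :=
  (∀ i, σ i ∈ coolOffStrategies f T ε i) ∧
    ∀ i, ∀ τ ∈ coolOffStrategies f T ε i,
      expectedPayoff p₀ f c δ (Function.update σ i τ) i ≤ expectedPayoff p₀ f c δ σ i

end Play

end CoolOff

end

open CoolOff

open MeasureTheory ProbabilityTheory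

noncomputable section

set_option linter.unusedSectionVars false

namespace CoolOff

/-! Given the state, the players' signals and drawn strategies are independent, so the probability
of an action history together with one player's signals factors into a weight for each player.
Player `i`'s uncertainty after `a` is measured by the Hellinger affinity `∑_x √(P(H,a,x) P(L,a,x))`
divided by `P(H,a)`; `Doubt` bounds this ratio by `η`. Since `hl/(h+l) ≤ √(hl)`, doubt dominates the
expected belief in `L` conditional on `H` and `a` (`expectedBeliefH_ge`). It therefore suffices to
choose `T` so that doubt stays below some `η < ε ^ 2` at every reached investment history.

Doubt is followed along a history (`doubt_le_of_reach_pos`). In a cool-off phase actions reveal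
nothing, and each fresh signal multiplies doubt by `β = ∑ √(f_H f_L) < 1`. After a failed
investment, full support of the signals bounds doubt by a constant depending only on the length of
the history, whatever the strategies (`doubt_crudeDoubt`); `T` is taken so large that the ensuing
cool-off phase brings this constant below `η`. After `(I, I)`, normalizing by the smaller
`H`-probability can raise doubt, but by a factor of at most `(1 - κ)⁻²` if both players invest with
probability at least `1 - κ` given `H`, and the fresh signal's factor `β ≤ (1 - κ) ^ 2` offsets this
(`Doubt.invest`).

The bound `1 - κ`, which is unrelated to the `1 - ε` imposed on strategies, comes from equilibrium
(`investProb_ge`). Small doubt makes most signals under `H` confident. A player who fails to invest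
at confident signals could invest there instead. The opponent invests with probability at least `1 -
ε > c` given `H`, so this gains a fixed amount at once, while failing to invest starts a long
cool-off phase and hence leaves the original plan at most a discounted tail to lose. So such
failures are rare. The deviation must itself respect the constraint; it does because a deviator
invests at every later investment history free of violations (`deviateMixed_mem`). -/

instance : Fintype Act := Fintype.ofFinite Act

theorem Act.eq_N_of_ne_I {b : Act} (h : b ≠ Act.I) : b = Act.N := by
  cases b
  · exact absurd rfl h
  · rfl

theorem fin_two_prod {i j : Fin 2} (hij : i ≠ j) (g : Fin 2 → ℝ) : ∏ k, g k = g i * g j := by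
  rw [Fin.prod_univ_two]
  fin_cases i <;> fin_cases j <;> simp_all [mul_comm]

theorem fin_two_forall {i j : Fin 2} (hij : i ≠ j) {p : Fin 2 → Prop} :
    (∀ k, p k) ↔ p i ∧ p j := by
  rw [Fin.forall_fin_two]
  fin_cases i <;> fin_cases j <;> simp_all [and_comm]

/-! ### Weights of signal and strategy sets -/

section Weights

variable {X : Type*}

/-- Player `i`'s signals in the first `n + 1` periods. -/
def signals (i : Fin 2) (n : ℕ) (x : ℕ → Fin 2 → X) : Fin (n + 1) → X := fun k => x k i

/-- The pure strategies consistent with `(a, x)`. -/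
def consistentSet (i : Fin 2) {n : ℕ} (a : ActionHistory n) (x : Fin (n + 1) → X) :
    Set (PureStrategy X) := {s | Consistent i s a x}

/-- The pure strategies consistent with `(a, x)` that choose `b` at `(a, x)`. -/
def choiceSet (i : Fin 2) {n : ℕ} (a : ActionHistory n) (b : Act) (x : Fin (n + 1) → X) :
    Set (PureStrategy X) := {s | Consistent i s a x ∧ s ⟨n, a, x⟩ = b}

/-- The weight of a signal-dependent set of pure strategies when signals are weighted by `w` and
pure strategies by `σ`. -/
def mass [Fintype X] (w : X → ℝ) (σ : Measure (PureStrategy X)) {n : ℕ}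
    (Q : (Fin (n + 1) → X) → Set (PureStrategy X)) : ℝ :=
  ∑ x : Fin (n + 1) → X, (∏ k, w (x k)) * σ.real (Q x)

/-- The signal probabilities in state `θ`. -/
def dens (f : State → PMF X) (θ : State) (x : X) : ℝ := (f θ x).toReal

theorem dens_nonneg (f : State → PMF X) (θ : State) (x : X) : 0 ≤ dens f θ x :=
  ENNReal.toReal_nonneg

theorem dens_pos {f : State → PMF X} (hfull : ∀ θ x, f θ x ≠ 0) (θ : State) (x : X) :
    0 < dens f θ x :=
  ENNReal.toReal_pos (hfull θ x) ((f θ).apply_ne_top x)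

theorem sum_dens [Fintype X] (f : State → PMF X) (θ : State) : ∑ x, dens f θ x = 1 := by
  have h := (f θ).tsum_coe
  rw [tsum_fintype] at h
  unfold dens
  rw [← ENNReal.toReal_sum (fun x _ => (f θ).apply_ne_top x), h, ENNReal.toReal_one]

theorem measurableSet_eval (h : PrivateHistory X) (b : Act) :
    MeasurableSet {s : PureStrategy X | s h = b} :=
  measurableSet_eq_fun (measurable_pi_apply h) measurable_const

theorem measurableSet_consistentSet (i : Fin 2) {n : ℕ} (a : ActionHistory n)
    (x : Fin (n + 1) → X) : MeasurableSet (consistentSet i a x) := by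
  simp only [consistentSet, Consistent, Set.ofPred_forall]
  exact MeasurableSet.iInter fun k => measurableSet_eval _ _

theorem measurableSet_choiceSet (i : Fin 2) {n : ℕ} (a : ActionHistory n) (b : Act)
    (x : Fin (n + 1) → X) : MeasurableSet (choiceSet i a b x) :=
  (measurableSet_consistentSet i a x).inter (measurableSet_eval _ _)

theorem consistent_succ_iff {n : ℕ} (i : Fin 2) (s : PureStrategy X) (a : ActionHistory (n + 1))
    (x : Fin (n + 2) → X) :
    Consistent i s a x ↔ Consistent i s (Fin.init a) (Fin.init x) ∧
      s ⟨n, Fin.init a, Fin.init x⟩ = a (Fin.last n) i := by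
  constructor
  · intro h
    exact ⟨fun k => h k.castSucc, h (Fin.last n)⟩
  · rintro ⟨h1, h2⟩ k
    refine Fin.lastCases ?_ (fun k => ?_) k
    · exact h2
    · exact h1 k

section Mass

variable [Fintype X] {w : X → ℝ} {σ : Measure (PureStrategy X)} {n : ℕ}

theorem mass_nonneg (hw : ∀ x, 0 ≤ w x) (Q : (Fin (n + 1) → X) → Set (PureStrategy X)) :
    0 ≤ mass w σ Q :=
  Finset.sum_nonneg fun _ _ => mul_nonneg (Finset.prod_nonneg fun _ _ => hw _) measureReal_nonneg

theorem mass_mono [IsFiniteMeasure σ] (hw : ∀ x, 0 ≤ w x)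
    {Q R : (Fin (n + 1) → X) → Set (PureStrategy X)} (h : ∀ x, Q x ⊆ R x) :
    mass w σ Q ≤ mass w σ R :=
  Finset.sum_le_sum fun x _ =>
    mul_le_mul_of_nonneg_left (measureReal_mono (h x)) (Finset.prod_nonneg fun k _ => hw _)

theorem mass_add_mass_diff [IsFiniteMeasure σ] (Q R : (Fin (n + 1) → X) → Set (PureStrategy X))
    (hR : ∀ x, MeasurableSet (R x)) :
    mass w σ (fun x => Q x ∩ R x) + mass w σ (fun x => Q x \ R x) = mass w σ Q := by
  unfold mass
  rw [← Finset.sum_add_distrib]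
  refine Finset.sum_congr rfl fun x _ => ?_
  rw [← mul_add, measureReal_inter_add_sdiff (hR x)]

theorem mass_le_mul {v : X → ℝ} {K : ℝ} (hv : ∀ x, 0 ≤ v x) (h : ∀ x, v x ≤ K * w x)
    (Q : (Fin (n + 1) → X) → Set (PureStrategy X)) :
    mass v σ Q ≤ K ^ (n + 1) * mass w σ Q := by
  unfold mass
  rw [Finset.mul_sum]
  refine Finset.sum_le_sum fun x _ => ?_
  rw [← mul_assoc]
  refine mul_le_mul_of_nonneg_right ?_ measureReal_nonneg
  calc ∏ k, v (x k) ≤ ∏ k, (K * w (x k)) := Finset.prod_le_prod (fun k _ => hv _) fun k _ => h _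
    _ = K ^ (n + 1) * ∏ k, w (x k) := by simp [Finset.prod_mul_distrib]

/-- A vanishing mass under full-support weights is a property of the strategy measure alone.
Reachability therefore does not depend on the state. -/
theorem mass_eq_zero_of_mass_eq_zero {v : X → ℝ} (hw : ∀ x, 0 < w x)
    {Q : (Fin (n + 1) → X) → Set (PureStrategy X)} (h : mass w σ Q = 0) : mass v σ Q = 0 := by
  unfold mass at *
  rw [Finset.sum_eq_zero_iff_of_nonneg fun x _ =>
    mul_nonneg (Finset.prod_nonneg fun k _ => (hw _).le) measureReal_nonneg] at h
  refine Finset.sum_eq_zero fun x hx => ?_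
  rw [(mul_eq_zero.1 (h x hx)).resolve_left (Finset.prod_pos fun k _ => hw _).ne', mul_zero]

/-- The last signal arrives after the last action of `a`, so consistency ignores it and it can be
summed out. Its factor is 1 for the signal law of a state and the Hellinger coefficient for `hell`.
-/
theorem mass_consistent_succ (i : Fin 2) (a : ActionHistory (n + 1)) :
    mass w σ (consistentSet i a) =
      (∑ x, w x) * mass w σ (choiceSet i (Fin.init a) (a (Fin.last n) i)) := by
  unfold mass
  rw [← (Fin.snocEquiv fun _ : Fin (n + 2) => X).sum_comp, Fintype.sum_prod_type, Finset.sum_mul]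
  refine Finset.sum_congr rfl fun y _ => ?_
  rw [Finset.mul_sum]
  refine Finset.sum_congr rfl fun x _ => ?_
  have : consistentSet (X := X) i a (Fin.snoc (α := fun _ => X) x y) =
      choiceSet i (Fin.init a) (a (Fin.last n) i) x := by
    ext s
    change Consistent i s a _ ↔ _
    rw [consistent_succ_iff]
    simp [choiceSet]
  change (∏ k, w (Fin.snoc (α := fun _ => X) x y k)) *
    σ.real (consistentSet i a (Fin.snoc (α := fun _ => X) x y)) = _
  rw [this, Fin.prod_univ_castSucc]
  simp only [Fin.snoc_castSucc, Fin.snoc_last]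
  ring

end Mass

end Weights

/-! ### Factorization of the law of play -/

section PlayLaw

variable {X : Type*}

theorem playHistory_apply (x : ℕ → Fin 2 → X) (s : Fin 2 → PureStrategy X) (n : ℕ) (k : Fin n) :
    playHistory x s n k = fun i => s i ⟨k, playHistory x s k, signals i k x⟩ := by
  induction n with
  | zero => exact k.elim0
  | succ n ih =>
    refine Fin.lastCases ?_ (fun k => ?_) k
    · simp only [playHistory, Fin.snoc_last]
      rfl
    · simp only [playHistory, Fin.snoc_castSucc, Fin.val_castSucc]
      exact ih k

theorem take_playHistory (x : ℕ → Fin 2 → X) (s : Fin 2 → PureStrategy X) {m n : ℕ} (h : m ≤ n) :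
    Fin.take m h (playHistory x s n) = playHistory x s m := by
  funext k
  rw [Fin.take_apply, playHistory_apply, playHistory_apply]
  rfl

/-- Reaching a history imposes a separate condition on each player, involving only that player's
signals and strategy. All factorizations below rest on this. -/
theorem playHistory_eq_iff (x : ℕ → Fin 2 → X) (s : Fin 2 → PureStrategy X) {n : ℕ}
    (a : ActionHistory n) :
    playHistory x s n = a ↔ ∀ i, Consistent i (s i) a (signals i n x) := by
  constructor
  · rintro rfl i k
    rw [playHistory_apply, take_playHistory]
    rfl
  · intro h
    have key : ∀ m (hm : m ≤ n), playHistory x s m = Fin.take m hm a := by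
      intro m
      induction m with
      | zero => intro _; funext k; exact k.elim0
      | succ m ih =>
        intro hm
        have ih' := ih (by omega)
        rw [playHistory]
        rw [Fin.take_succ_eq_snoc m hm a, ih']
        congr 1
        funext i
        exact h i ⟨m, hm⟩
    simpa using key n le_rfl

variable [MeasurableSpace X]

theorem measurable_signals (i : Fin 2) (n : ℕ) :
    Measurable fun z : (ℕ → Fin 2 → X) × (Fin 2 → PureStrategy X) => signals i n z.1 := by
  unfold signals
  fun_prop

variable [Fintype X] [DiscreteMeasurableSpace X]

instance (f : State → PMF X) (σ : Fin 2 → MixedStrategy X) (θ : State) :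
    IsProbabilityMeasure (drawLaw f σ θ) := by
  unfold drawLaw; infer_instance

theorem drawLaw_cylinder (f : State → PMF X) (σ : Fin 2 → MixedStrategy X) (θ : State) {n : ℕ}
    (x : Fin 2 → Fin (n + 1) → X) (Q : Fin 2 → Set (PureStrategy X)) :
    (drawLaw f σ θ).real {z | (∀ i, signals i n z.1 = x i) ∧ ∀ i, z.2 i ∈ Q i} =
      ∏ i, (∏ k, dens f θ (x i k)) * (σ i : Measure (PureStrategy X)).real (Q i) := by
  have e : {z : (ℕ → Fin 2 → X) × (Fin 2 → PureStrategy X) |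
      (∀ i, signals i n z.1 = x i) ∧ ∀ i, z.2 i ∈ Q i} =
      (Set.pi (Finset.range (n + 1)) fun k => if h : k < n + 1 then
        Set.pi Set.univ (fun i => {x i ⟨k, h⟩}) else Set.univ) ×ˢ Set.pi Set.univ Q := by
    ext z
    simp only [Set.mem_ofPred_eq, Set.mem_prod, Set.mem_pi, Set.mem_univ, true_imp_iff,
      Finset.coe_range, Set.mem_Iio]
    refine and_congr_left fun _ => ⟨fun h k hk => ?_, fun h i => ?_⟩
    · rw [dif_pos hk]
      intro i _
      exact congrFun (h i) ⟨k, hk⟩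
    · funext k
      have := h k k.isLt
      rw [dif_pos k.isLt] at this
      exact this i trivial
  rw [measureReal_def, e, drawLaw, Measure.prod_prod, Measure.pi_pi, Measure.infinitePi_pi,
    ENNReal.toReal_mul, ENNReal.toReal_prod, ENNReal.toReal_prod, Finset.prod_mul_distrib]
  · congr 1
    rw [Finset.prod_range, Finset.prod_comm]
    refine Finset.prod_congr rfl fun k _ => ?_
    rw [dif_pos k.isLt, Measure.pi_pi, ENNReal.toReal_prod]
    refine Finset.prod_congr rfl fun i _ => ?_
    rw [PMF.toMeasure_apply_singleton _ _ (measurableSet_singleton _)]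
    rfl
  · intro k _
    split_ifs
    · exact MeasurableSet.univ_pi fun i => measurableSet_singleton _
    · exact MeasurableSet.univ

theorem measurableSet_draw {n : ℕ}
    {Q : Fin 2 → (Fin (n + 1) → X) → Set (PureStrategy X)}
    (hQ : ∀ i x, MeasurableSet (Q i x)) :
    MeasurableSet {z : (ℕ → Fin 2 → X) × (Fin 2 → PureStrategy X) |
      ∀ i, z.2 i ∈ Q i (signals i n z.1)} := by
  have e : {z : (ℕ → Fin 2 → X) × (Fin 2 → PureStrategy X) |
      ∀ i, z.2 i ∈ Q i (signals i n z.1)} =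
      ⋂ i, ⋃ x, ({z | signals i n z.1 = x} ∩ (fun z => z.2 i) ⁻¹' Q i x) := by
    ext z; simp
  rw [e]
  refine MeasurableSet.iInter fun i => MeasurableSet.iUnion fun x => ?_
  refine ((measurable_signals i n) (measurableSet_singleton x)).inter ?_
  exact ((measurable_pi_apply i).comp measurable_snd) (hQ i x)

/-- Independence given the state: an event that restricts each player through her own signals and
strategy has product probability. The proof decomposes it over the finitely many signal profiles of
the first `n + 1` periods. -/
theorem drawLaw_real (f : State → PMF X) (σ : Fin 2 → MixedStrategy X) (θ : State) {n : ℕ}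
    (Q : Fin 2 → (Fin (n + 1) → X) → Set (PureStrategy X))
    (hQ : ∀ i x, MeasurableSet (Q i x)) :
    (drawLaw f σ θ).real {z | ∀ i, z.2 i ∈ Q i (signals i n z.1)} =
      ∏ i, mass (dens f θ) (σ i : Measure (PureStrategy X)) (Q i) := by
  have e : {z : (ℕ → Fin 2 → X) × (Fin 2 → PureStrategy X) |
      ∀ i, z.2 i ∈ Q i (signals i n z.1)} =
      ⋃ x ∈ (Finset.univ : Finset (Fin 2 → Fin (n + 1) → X)),
        {z | (∀ i, signals i n z.1 = x i) ∧ ∀ i, z.2 i ∈ Q i (x i)} := by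
    ext z
    simp only [Set.mem_ofPred_eq, Finset.mem_univ, Set.iUnion_true, Set.mem_iUnion]
    constructor
    · intro h
      exact ⟨fun i => signals i n z.1, fun i => rfl, h⟩
    · rintro ⟨x, hx, h⟩ i
      rw [hx i]; exact h i
  rw [e, measureReal_biUnion_finset]
  · simp_rw [drawLaw_cylinder f σ θ]
    unfold mass
    rw [Finset.prod_univ_sum]
    simp
  · intro x _ y _ hxy
    refine Set.disjoint_left.2 fun z hx hy => hxy ?_
    funext i
    rw [← hx.1 i, hy.1 i]
  · intro x _
    have e2 : {z : (ℕ → Fin 2 → X) × (Fin 2 → PureStrategy X) |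
        (∀ i, signals i n z.1 = x i) ∧ ∀ i, z.2 i ∈ Q i (x i)} =
        {z | ∀ i, z.2 i ∈ (fun y => {s | y = x i ∧ s ∈ Q i (x i)} : (Fin (n + 1) → X) →
          Set (PureStrategy X)) (signals i n z.1)} := by
      ext z; simp [forall_and]
    rw [e2]
    refine measurableSet_draw (Q := fun i y => {s | y = x i ∧ s ∈ Q i (x i)}) fun i y => ?_
    exact (MeasurableSet.const _).inter (hQ i _)

end PlayLaw

/-! ### The investment constraint in linear form -/

section Constraint

variable {X : Type*}

theorem consistentSet_succ (i : Fin 2) {n : ℕ} (a : ActionHistory (n + 1)) (x : Fin (n + 2) → X) :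
    consistentSet i a x = choiceSet i (Fin.init a) (a (Fin.last n) i) (Fin.init x) := by
  ext s
  exact consistent_succ_iff i s a x

theorem choiceSet_subset (i : Fin 2) {n : ℕ} (a : ActionHistory n) (b : Act) (x : Fin (n + 1) → X) :
    choiceSet i a b x ⊆ consistentSet i a x := fun _ h => h.1

theorem isOpen_consistentSet (i : Fin 2) {n : ℕ} (a : ActionHistory n)
    (x : Fin (n + 1) → X) : IsOpen (consistentSet i a x) := by
  simp only [consistentSet, Consistent, Set.ofPred_forall]
  refine isOpen_iInter_of_finite fun k => ?_
  exact continuous_def.1 (continuous_apply (A := fun _ : PrivateHistory X => Act) _) {a k i}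
    (isOpen_discrete _)

theorem mul_behavior (i : Fin 2) (σ : MixedStrategy X) {n : ℕ} (a : ActionHistory n)
    (x : Fin (n + 1) → X) (b : Act) :
    (σ : Measure (PureStrategy X)).real (consistentSet i a x) * behavior i σ a x b =
      (σ : Measure (PureStrategy X)).real (choiceSet i a b x) := by
  change (σ : Measure (PureStrategy X)).real (consistentSet i a x) *
    ((σ : Measure (PureStrategy X)).real (choiceSet i a b x) /
      (σ : Measure (PureStrategy X)).real (consistentSet i a x)) = _
  by_cases h : (σ : Measure (PureStrategy X)).real (consistentSet i a x) = 0
  · rw [h, zero_mul]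
    exact le_antisymm measureReal_nonneg (h ▸ measureReal_mono (choiceSet_subset i a b x))
  · field_simp

/-- The conditional probabilities telescope. Null histories are no exception: in `mul_behavior` a
zero denominator forces a zero numerator. -/
theorem pastWeight_eq (i : Fin 2) (σ : MixedStrategy X) {n : ℕ} (a : ActionHistory n)
    (x : Fin (n + 1) → X) :
    pastWeight i σ a x = (σ : Measure (PureStrategy X)).real (consistentSet i a x) := by
  induction n with
  | zero =>
    have : consistentSet (X := X) i a x = Set.univ := by
      ext s; simp [consistentSet, Consistent]
    simp [pastWeight, this]
  | succ n ih =>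
    rw [consistentSet_succ, ← mul_behavior, ← ih, pastWeight, Fin.prod_univ_castSucc]
    rfl

theorem investProbH_eq [Fintype X] (f : State → PMF X) (i : Fin 2) (σ : MixedStrategy X) {n : ℕ}
    (a : ActionHistory n) :
    investProbH f i σ a =
      mass (dens f State.H) (σ : Measure (PureStrategy X)) (choiceSet i a Act.I) /
        mass (dens f State.H) (σ : Measure (PureStrategy X)) (consistentSet i a) := by
  simp only [investProbH, pastWeight_eq, mul_behavior]
  rfl

/-- Membership in `coolOffStrategies`, with the constraint in a form that is linear in `σ`. -/
theorem mem_coolOffStrategies_iff [Fintype X] {f : State → PMF X} (hfull : ∀ θ x, f θ x ≠ 0)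
    (T : ℕ → ℕ) (ε : ℝ) (i : Fin 2) (σ : MixedStrategy X) :
    σ ∈ coolOffStrategies f T ε i ↔
      (σ : Measure (PureStrategy X)).support ⊆ coolOffPure X T ∧
      ∀ (n : ℕ) (a : ActionHistory n), IsInvestment T a → ¬ CoolOffBreach T a →
        (1 - ε) * mass (dens f State.H) (σ : Measure (PureStrategy X)) (consistentSet i a) ≤
          mass (dens f State.H) (σ : Measure (PureStrategy X)) (choiceSet i a Act.I) := by
  refine and_congr_right fun _ => forall_congr' fun n => forall_congr' fun a =>
    forall_congr' fun _ => forall_congr' fun _ => ?_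
  have h0 : 0 ≤ mass (dens f State.H) (σ : Measure (PureStrategy X)) (consistentSet i a) :=
    mass_nonneg (dens_nonneg f _) _
  rw [investProbH_eq]
  -- Full support of the signals and openness of `consistentSet` make consistency with the support
  -- equivalent to a positive denominator. Where the denominator vanishes, the linear inequality is
  -- trivial.
  constructor
  · intro h
    rcases h0.eq_or_lt with h1 | h1
    · rw [← h1, mul_zero]
      exact mass_nonneg (dens_nonneg f _) _
    · rw [← le_div_iff₀ h1]
      refine h ?_
      obtain ⟨x, -, hx⟩ := Finset.exists_ne_zero_of_sum_ne_zero h1.ne'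
      have hx' : 0 < (σ : Measure (PureStrategy X)) (consistentSet i a x) := by
        rw [pos_iff_ne_zero]
        intro h
        simp [measureReal_def, h] at hx
      obtain ⟨s, hs1, hs2⟩ := Measure.nonempty_inter_support_of_pos hx'
      exact ⟨x, s, hs2, hs1⟩
  · rintro h ⟨x, s, hs, hx⟩
    refine (le_div_iff₀ ?_).2 h
    refine Finset.sum_pos' (fun y _ => mul_nonneg (Finset.prod_nonneg fun k _ => dens_nonneg f _ _)
      measureReal_nonneg) ⟨x, Finset.mem_univ _, mul_pos
        (Finset.prod_pos fun k _ => dens_pos hfull _ _) ?_⟩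
    refine ENNReal.toReal_pos ?_ (measure_ne_top _ _)
    exact ((Measure.mem_support_iff_forall s).1 hs _
      ((isOpen_consistentSet i a x).mem_nhds hx)).ne'

theorem isClosed_coolOffPure (T : ℕ → ℕ) : IsClosed (coolOffPure X T) := by
  have hc : ∀ h : PrivateHistory X, IsClosed {s : PureStrategy X | s h = Act.N} := fun h =>
    isClosed_eq (continuous_apply h) continuous_const
  have : coolOffPure X T = ⋂ (n : ℕ) (a : ActionHistory n) (x : Fin (n + 1) → X)
      (_ : IsCoolOff T a ∨ CoolOffBreach T a), {s : PureStrategy X | s ⟨n, a, x⟩ = Act.N} := by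
    ext s
    simp only [coolOffPure, Set.mem_ofPred_eq, Set.mem_iInter]
    constructor
    · rintro ⟨h1, h2⟩ n a x (h | h)
      · exact h1 n a x h
      · exact h2 n a x h
    · intro h
      exact ⟨fun n a x hh => h n a x (Or.inl hh), fun n a x hh => h n a x (Or.inr hh)⟩
  rw [this]
  exact isClosed_iInter fun n => isClosed_iInter fun a => isClosed_iInter fun x =>
    isClosed_iInter fun _ => hc _

theorem ae_mem_coolOffPure [Finite X] {T : ℕ → ℕ} {σ : MixedStrategy X}
    (h : (σ : Measure (PureStrategy X)).support ⊆ coolOffPure X T) :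
    ∀ᵐ s ∂(σ : Measure (PureStrategy X)), s ∈ coolOffPure X T :=
  Filter.mem_of_superset Measure.support_mem_ae h

end Constraint

/-! ### Expected beliefs and the Hellinger doubt -/

section Belief

variable {X : Type*}

theorem outcome_history (θ : State) (z : (ℕ → Fin 2 → X) × (Fin 2 → PureStrategy X)) (n : ℕ) :
    (fun k : Fin n => (outcome θ z).2.2 k) = playHistory z.1 z.2 n := by
  funext k
  rw [playHistory_apply]
  rfl

variable [MeasurableSpace X]

theorem measurableSet_highState : MeasurableSet (highState X) :=
  measurable_fst (MeasurableSet.of_discrete (s := {State.H}))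

theorem measurable_privateHistory (i : Fin 2) (n : ℕ) :
    Measurable (privateHistory (X := X) i n) := by
  unfold privateHistory
  fun_prop

theorem measurableSet_historyEvent {n : ℕ} (a : ActionHistory n) :
    MeasurableSet (historyEvent X a) := by
  refine measurableSet_eq_fun ?_ measurable_const
  fun_prop

variable [Fintype X] [DiscreteMeasurableSpace X]

theorem outcomeLaw_real {p₀ : ℝ} (hp₀ : p₀ ∈ Set.Ioo (0 : ℝ) 1) (f : State → PMF X)
    (σ : Fin 2 → MixedStrategy X) {S : Set (Outcome X)} (hS : MeasurableSet S) :
    (outcomeLaw p₀ f σ).real S = p₀ * (drawLaw f σ State.H).real (outcome State.H ⁻¹' S) +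
      (1 - p₀) * (drawLaw f σ State.L).real (outcome State.L ⁻¹' S) := by
  rw [measureReal_def, outcomeLaw, Measure.add_apply, Measure.smul_apply, Measure.smul_apply,
    Measure.map_apply (measurable_outcome _) hS, Measure.map_apply (measurable_outcome _) hS,
    smul_eq_mul, smul_eq_mul,
    ENNReal.toReal_add (ENNReal.mul_ne_top ENNReal.ofReal_ne_top (measure_ne_top _ _))
      (ENNReal.mul_ne_top ENNReal.ofReal_ne_top (measure_ne_top _ _)),
    ENNReal.toReal_mul, ENNReal.toReal_mul, ENNReal.toReal_ofReal hp₀.1.le,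
    ENNReal.toReal_ofReal (by linarith [hp₀.2])]
  rfl

instance (p₀ : ℝ) (f : State → PMF X) (σ : Fin 2 → MixedStrategy X) :
    IsFiniteMeasure (outcomeLaw p₀ f σ) := by
  constructor
  rw [outcomeLaw, Measure.add_apply, Measure.smul_apply, Measure.smul_apply, smul_eq_mul,
    smul_eq_mul]
  exact ENNReal.add_lt_top.2 ⟨ENNReal.mul_lt_top ENNReal.ofReal_lt_top (by
    rw [Measure.map_apply (measurable_outcome _) MeasurableSet.univ]; exact measure_lt_top _ _),
    ENNReal.mul_lt_top ENNReal.ofReal_lt_top (by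
    rw [Measure.map_apply (measurable_outcome _) MeasurableSet.univ]; exact measure_lt_top _ _)⟩

/-- The weight of the signals and strategies of a player that are compatible with a history. -/
abbrev reach (w : X → ℝ) (σ : Fin 2 → MixedStrategy X) (i : Fin 2) {n : ℕ}
    (a : ActionHistory n) : ℝ :=
  mass w (σ i : Measure (PureStrategy X)) (consistentSet i a)

theorem drawLaw_history (f : State → PMF X) (σ : Fin 2 → MixedStrategy X) (θ : State) {n : ℕ}
    (a : ActionHistory n) {i j : Fin 2} (hij : i ≠ j)
    (P : (Fin (n + 1) → X) → Set (PureStrategy X)) (hP : ∀ x, MeasurableSet (P x)) :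
    (drawLaw f σ θ).real {z | playHistory z.1 z.2 n = a ∧ z.2 i ∈ P (signals i n z.1)} =
      mass (dens f θ) (σ i : Measure (PureStrategy X)) (fun x => consistentSet i a x ∩ P x) *
        reach (dens f θ) σ j a := by
  classical
  have h := drawLaw_real f σ θ (n := n)
    (fun k x => if k = i then consistentSet i a x ∩ P x else consistentSet k a x)
    (fun k x => by
      split_ifs
      · exact (measurableSet_consistentSet i a x).inter (hP x)
      · exact measurableSet_consistentSet k a x)
  rw [fin_two_prod hij] at h
  simp only [if_true, if_neg hij.symm] at h
  rw [← h]
  congr 1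
  ext z
  simp only [Set.mem_ofPred_eq, playHistory_eq_iff, fin_two_forall hij, if_true, if_neg hij.symm,
    Set.mem_inter_iff, consistentSet]
  tauto

theorem drawLaw_reach (f : State → PMF X) (σ : Fin 2 → MixedStrategy X) (θ : State) {n : ℕ}
    (a : ActionHistory n) {i j : Fin 2} (hij : i ≠ j) :
    (drawLaw f σ θ).real {z | playHistory z.1 z.2 n = a} =
      reach (dens f θ) σ i a * reach (dens f θ) σ j a := by
  simpa using drawLaw_history f σ θ a hij (fun _ => Set.univ) (fun _ => MeasurableSet.univ)

theorem reach_pos_of_outcomeLaw_ne_zero {p₀ : ℝ} (hp₀ : p₀ ∈ Set.Ioo (0 : ℝ) 1) {f : State → PMF X}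
    (hfull : ∀ θ x, f θ x ≠ 0) (σ : Fin 2 → MixedStrategy X) {n : ℕ} (a : ActionHistory n)
    (h : outcomeLaw p₀ f σ (historyEvent X a) ≠ 0) (i : Fin 2) (θ : State) :
    0 < reach (dens f θ) σ i a := by
  refine (mass_nonneg (dens_nonneg f _) _).lt_of_ne fun h0 => h ?_
  obtain ⟨j, hij⟩ := exists_ne i
  have key : ∀ θ', (drawLaw f σ θ').real (outcome θ' ⁻¹' historyEvent X a) = 0 := by
    intro θ'
    have e : outcome θ' ⁻¹' historyEvent X a = {z | playHistory z.1 z.2 n = a} := by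
      ext z
      simp only [historyEvent, Set.mem_preimage, Set.mem_ofPred_eq, outcome_history]
    have h1 : reach (dens f θ') σ i a = 0 :=
      mass_eq_zero_of_mass_eq_zero (dens_pos hfull θ) h0.symm
    rw [e, drawLaw_reach f σ θ' a hij.symm, h1, zero_mul]
  have := outcomeLaw_real hp₀ f σ (measurableSet_historyEvent a)
  rw [key, key, mul_zero, mul_zero, add_zero] at this
  exact (measureReal_eq_zero_iff).1 this

/-- The Hellinger weight of a signal. -/
def hell (f : State → PMF X) (x : X) : ℝ := √(dens f State.H x * dens f State.L x)

/-- The Hellinger-type doubt of player `i` about the high state after `a` is at most `η`. -/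
def Doubt (p₀ : ℝ) (f : State → PMF X) (σ : Fin 2 → MixedStrategy X) (i j : Fin 2) {n : ℕ}
    (a : ActionHistory n) (η : ℝ) : Prop :=
  reach (hell f) σ i a * √((1 - p₀) * reach (dens f State.L) σ j a) ≤
    η * (reach (dens f State.H) σ i a * √(p₀ * reach (dens f State.H) σ j a))

/-- With `h` and `l` the joint weights of a private history and the two states, the left side is the
contribution of that history to the misplaced belief under `H`. -/
theorem mul_div_add_le_sqrt {h l : ℝ} (hh : 0 ≤ h) (hl : 0 ≤ l) : h * l / (h + l) ≤ √h * √l := by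
  rcases (add_nonneg hh hl).eq_or_lt with h0 | h0
  · rw [← h0, div_zero]; positivity
  · rw [div_le_iff₀ h0]
    have h1 := Real.sq_sqrt hh
    have h2 := Real.sq_sqrt hl
    have h3 := Real.sqrt_nonneg h
    have h4 := Real.sqrt_nonneg l
    have : √h * √l * (√h * √l) ≤ √h * √l * (h + l) := by
      refine mul_le_mul_of_nonneg_left ?_ (by positivity)
      nlinarith [sq_nonneg (√h - √l)]
    calc h * l = √h * √l * (√h * √l) := by rw [← h1, ← h2]; simp; ring
      _ ≤ _ := this

/-- The event that `H` holds and `a` is played splits into the cells `F x` of player `i`'s private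
histories, on each of which the belief is the constant `h / (h + l)`. The total loss `∑ (h -
h²/(h+l)) = ∑ hl/(h+l)` is at most `∑ √h √l`, which is the affinity bounded by `Doubt`. -/
theorem expectedBeliefH_ge {p₀ : ℝ} (hp₀ : p₀ ∈ Set.Ioo (0 : ℝ) 1) {f : State → PMF X}
    (σ : Fin 2 → MixedStrategy X) {i j : Fin 2} (hij : i ≠ j) {n : ℕ}
    (a : ActionHistory n) {η : ℝ} (hpos : ∀ k, 0 < reach (dens f State.H) σ k a)
    (hη : Doubt p₀ f σ i j a η) : 1 - η ≤ expectedBeliefH p₀ f σ i a := by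
  classical
  set μ := outcomeLaw p₀ f σ with hμ
  set E := highState X ∩ historyEvent X a with hE
  let F : (Fin (n + 1) → X) → Set (Outcome X) := fun x => {ω | privateHistory i n ω = (a, x)}
  have hFm : ∀ x, MeasurableSet (F x) := fun x =>
    measurableSet_eq_fun (measurable_privateHistory i n) measurable_const
  let s : (Fin (n + 1) → X) → ℝ := fun x =>
    (σ i : Measure (PureStrategy X)).real (consistentSet i a x)
  let q : State → (Fin (n + 1) → X) → ℝ := fun θ x =>
    (∏ k, dens f θ (x k)) * s x * reach (dens f θ) σ j a
  have hdraw : ∀ θ x, (drawLaw f σ θ).real (outcome θ ⁻¹' F x) = q θ x := by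
    intro θ x
    have e : outcome θ ⁻¹' F x = {z | playHistory z.1 z.2 n = a ∧
        z.2 i ∈ (fun y => {_s | y = x} : (Fin (n + 1) → X) → Set (PureStrategy X))
          (signals i n z.1)} := by
      ext z
      simp only [F, Set.mem_preimage, Set.mem_ofPred_eq, privateHistory, Prod.mk.injEq,
        outcome_history]
      rfl
    rw [e, drawLaw_history f σ θ a hij (fun y => {_s | y = x}) fun y => MeasurableSet.const _]
    congr 1
    unfold mass
    rw [Finset.sum_eq_single x]
    · simp [s]
    · intro y _ hy
      simp [hy]
    · simp
  have hhigh : ∀ θ x, (drawLaw f σ θ).real (outcome θ ⁻¹' (highState X ∩ F x)) =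
      if θ = State.H then q θ x else 0 := by
    intro θ x
    split_ifs with h
    · rw [← hdraw]
      congr 1
      ext z
      simp [highState, outcome, h]
    · have : outcome θ ⁻¹' (highState X ∩ F x) = ∅ := by
        ext z
        simp [highState, outcome, h]
      rw [this, measureReal_empty]
  have hHF : ∀ x, μ.real (highState X ∩ F x) = p₀ * q State.H x := by
    intro x
    rw [hμ, outcomeLaw_real hp₀ f σ (measurableSet_highState.inter (hFm x)), hhigh, hhigh]
    simp
  have hF : ∀ x, μ.real (F x) = p₀ * q State.H x + (1 - p₀) * q State.L x := by
    intro x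
    rw [hμ, outcomeLaw_real hp₀ f σ (hFm x), hdraw, hdraw]
  have hEU : E = ⋃ x ∈ (Finset.univ : Finset (Fin (n + 1) → X)), (highState X ∩ F x) := by
    ext ω
    simp [hE, F, privateHistory, historyEvent]
  have hdisj : Set.Pairwise (↑(Finset.univ : Finset (Fin (n + 1) → X)))
      (Function.onFun Disjoint fun x => highState X ∩ F x) := by
    intro x _ y _ hxy
    refine Set.disjoint_left.2 fun ω h1 h2 => hxy ?_
    have := h1.2.symm.trans h2.2
    simpa using this
  have hq0 : ∀ θ x, 0 ≤ q θ x := fun θ x =>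
    mul_nonneg (mul_nonneg (Finset.prod_nonneg fun k _ => dens_nonneg f _ _) measureReal_nonneg)
      (mass_nonneg (dens_nonneg f _) _)
  have hEreal : μ.real E = ∑ x, p₀ * q State.H x := by
    rw [hEU, measureReal_biUnion_finset hdisj fun x _ => measurableSet_highState.inter (hFm x)]
    exact Finset.sum_congr rfl fun x _ => hHF x
  have hEval : μ.real E = p₀ * (reach (dens f State.H) σ i a * reach (dens f State.H) σ j a) := by
    rw [hEreal, ← Finset.mul_sum, ← Finset.sum_mul]
    rfl
  have hint : ∫ ω in E, privateBelief p₀ f σ i n ω ∂μ =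
      ∑ x, p₀ * q State.H x * (p₀ * q State.H x /
        (p₀ * q State.H x + (1 - p₀) * q State.L x)) := by
    have hval : ∀ x, Set.EqOn (privateBelief p₀ f σ i n) (fun _ => p₀ * q State.H x /
        (p₀ * q State.H x + (1 - p₀) * q State.L x)) (highState X ∩ F x) := by
      intro x ω hω
      have h2 : privateHistory i n ω = (a, x) := hω.2
      change ((outcomeLaw p₀ f σ)[|{ω' | privateHistory i n ω' = privateHistory i n ω}]).real
        (highState X) = _
      rw [h2]
      change (μ[|F x]).real (highState X) = _
      rw [measureReal_def, cond_apply (hFm x), ENNReal.toReal_mul, ENNReal.toReal_inv,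
        ← measureReal_def, ← measureReal_def, Set.inter_comm, hHF, hF, inv_mul_eq_div]
    rw [hEU, integral_biUnion_finset _ (fun x _ => measurableSet_highState.inter (hFm x)) hdisj]
    · refine Finset.sum_congr rfl fun x _ => ?_
      rw [setIntegral_congr_fun (measurableSet_highState.inter (hFm x)) (hval x),
        setIntegral_const, hHF, smul_eq_mul]
    · intro x _
      exact (integrableOn_congr_fun (hval x) (measurableSet_highState.inter (hFm x))).2
        (integrableOn_const (measure_ne_top _ _))
  have hEpos : 0 < μ.real E := by
    rw [hEval]
    exact mul_pos hp₀.1 (mul_pos (hpos i) (hpos j))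
  have hexp : expectedBeliefH p₀ f σ i a =
      (μ.real E)⁻¹ * ∫ ω in E, privateBelief p₀ f σ i n ω ∂μ := by
    rw [expectedBeliefH, ← hμ, ← hE, ProbabilityTheory.cond, integral_smul_measure]
    simp [measureReal_def]
  have hloss : μ.real E - ∫ ω in E, privateBelief p₀ f σ i n ω ∂μ ≤
      ∑ x, √(p₀ * q State.H x) * √((1 - p₀) * q State.L x) := by
    rw [hint, hEreal, ← Finset.sum_sub_distrib]
    refine Finset.sum_le_sum fun x _ => ?_
    have h1 : 0 ≤ p₀ * q State.H x := mul_nonneg hp₀.1.le (hq0 _ _)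
    have h2 : 0 ≤ (1 - p₀) * q State.L x := mul_nonneg (by linarith [hp₀.2]) (hq0 _ _)
    refine le_trans (le_of_eq ?_) (mul_div_add_le_sqrt h1 h2)
    rcases (add_nonneg h1 h2).eq_or_lt with h0 | h0
    · have : p₀ * q State.H x = 0 := by linarith
      simp [this]
    · field_simp
      ring
  -- The weight `s x` of player `i`'s own strategy is the same in both states and leaves the two
  -- roots intact. The opponent's factors do not depend on `x` and stay under the roots. This
  -- explains the asymmetric shape of `Doubt`.
  have hsum : ∑ x, √(p₀ * q State.H x) * √((1 - p₀) * q State.L x) =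
      √(p₀ * reach (dens f State.H) σ j a) *
        (reach (hell f) σ i a * √((1 - p₀) * reach (dens f State.L) σ j a)) := by
    have hB : reach (hell f) σ i a = ∑ x, (∏ k, hell f (x k)) * s x := rfl
    rw [hB, Finset.sum_mul, Finset.mul_sum]
    refine Finset.sum_congr rfl fun x _ => ?_
    have hs : 0 ≤ s x := measureReal_nonneg
    have hg : ∀ θ, 0 ≤ ∏ k, dens f θ (x k) := fun θ => Finset.prod_nonneg fun k _ => dens_nonneg f _ _
    have e1 : ∀ θ (p : ℝ), p * q θ x = (∏ k, dens f θ (x k)) * (s x *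
        (p * reach (dens f θ) σ j a)) := by
      intro θ p; simp only [q]; ring
    have e2 : ∏ k, hell f (x k) = √(∏ k, dens f State.H (x k)) * √(∏ k, dens f State.L (x k)) := by
      rw [← Real.sqrt_mul (hg _), ← Finset.prod_mul_distrib]
      exact (Real.sqrt_prod _ fun k _ => mul_nonneg (dens_nonneg f _ _) (dens_nonneg f _ _)).symm
    rw [e1, e1, Real.sqrt_mul (hg _), Real.sqrt_mul (hg _), Real.sqrt_mul hs, Real.sqrt_mul hs, e2]
    calc _ = √(∏ k, dens f State.H (x k)) * √(∏ k, dens f State.L (x k)) * (√(s x) * √(s x)) *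
          (√(p₀ * reach (dens f State.H) σ j a) * √((1 - p₀) * reach (dens f State.L) σ j a)) := by
          ring
      _ = _ := by rw [Real.mul_self_sqrt hs]; simp only [s, reach]; ring
  have hfin : μ.real E - ∫ ω in E, privateBelief p₀ f σ i n ω ∂μ ≤ η * μ.real E := by
    rw [hsum] at hloss
    refine hloss.trans ((mul_le_mul_of_nonneg_left hη (Real.sqrt_nonneg _)).trans (le_of_eq ?_))
    have h0 : 0 ≤ p₀ * reach (dens f State.H) σ j a := mul_nonneg hp₀.1.le (hpos j).le
    rw [hEval]
    calc _ = η * reach (dens f State.H) σ i a * (√(p₀ * reach (dens f State.H) σ j a) *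
          √(p₀ * reach (dens f State.H) σ j a)) := by ring
      _ = _ := by rw [Real.mul_self_sqrt h0]; ring
  rw [hexp, inv_mul_eq_div, le_div_iff₀ hEpos]
  linarith

end Belief

/-! ### The deviation and its admissibility -/

section Deviation

variable {X : Type*} {n : ℕ}

open Classical in
/-- The deviation at the action history `a`: a player who would choose `N` at `a` invests instead if
her signals lie in `D`, and in any case invests at all later investment histories. -/
def deviate (T : ℕ → ℕ) (a : ActionHistory n) (D : Set (Fin (n + 1) → X)) (s : PureStrategy X) :
    PureStrategy X := fun h =>
  if ∃ hn : n ≤ h.1, Fin.take n hn h.2.1 = a ∧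
      s ⟨n, a, Fin.take (n + 1) (Nat.succ_le_succ hn) h.2.2⟩ = Act.N ∧
      (h.1 = n → Fin.take (n + 1) (Nat.succ_le_succ hn) h.2.2 ∈ D) ∧
      IsInvestment T h.2.1 ∧ ¬ CoolOffBreach T h.2.1
  then Act.I else s h

variable {T : ℕ → ℕ} {a : ActionHistory n} {D : Set (Fin (n + 1) → X)} {s : PureStrategy X}

theorem deviate_eq_self {m : ℕ} {a' : ActionHistory m} {x : Fin (m + 1) → X}
    (h : ∀ hn : n ≤ m, Fin.take n hn a' = a →
      s ⟨n, a, Fin.take (n + 1) (Nat.succ_le_succ hn) x⟩ ≠ Act.N) :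
    deviate T a D s ⟨m, a', x⟩ = s ⟨m, a', x⟩ := by
  unfold deviate
  rw [if_neg]
  rintro ⟨hn, h1, h2, -⟩
  exact h hn h1 h2

theorem deviate_eq_I {m : ℕ} {a' : ActionHistory m} {x : Fin (m + 1) → X} (hn : n ≤ m)
    (h1 : Fin.take n hn a' = a)
    (h2 : s ⟨n, a, Fin.take (n + 1) (Nat.succ_le_succ hn) x⟩ = Act.N)
    (h3 : m = n → Fin.take (n + 1) (Nat.succ_le_succ hn) x ∈ D)
    (h4 : IsInvestment T a') (h5 : ¬ CoolOffBreach T a') :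
    deviate T a D s ⟨m, a', x⟩ = Act.I := by
  unfold deviate
  exact if_pos ⟨hn, h1, h2, h3, h4, h5⟩

theorem deviate_eq_I_of_eq_I {h : PrivateHistory X} (hs : s h = Act.I) :
    deviate T a D s h = Act.I := by
  unfold deviate
  split_ifs
  · rfl
  · exact hs

theorem deviate_self_of_notMem {x : Fin (n + 1) → X} (h : x ∉ D) :
    deviate T a D s ⟨n, a, x⟩ = s ⟨n, a, x⟩ := by
  unfold deviate
  rw [if_neg]
  rintro ⟨hn, -, -, h3, -⟩
  exact h (h3 rfl)

theorem deviate_mem_coolOffPure (hs : s ∈ coolOffPure X T) :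
    deviate T a D s ∈ coolOffPure X T := by
  constructor
  · intro m a' x h
    unfold deviate
    rw [if_neg]
    · exact hs.1 m a' x h
    · rintro ⟨-, -, -, -, h4, -⟩
      exact h h4
  · intro m a' x h
    unfold deviate
    rw [if_neg]
    · exact hs.2 m a' x h
    · rintro ⟨-, -, -, -, -, h5⟩
      exact h5 h

theorem measurable_deviate : Measurable (deviate T a D) := by
  classical
  refine measurable_pi_iff.2 fun h => ?_
  unfold deviate
  refine Measurable.ite ?_ measurable_const (measurable_pi_apply h)
  by_cases hn : n ≤ h.1
  · by_cases hc : Fin.take n hn h.2.1 = a ∧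
      (h.1 = n → Fin.take (n + 1) (Nat.succ_le_succ hn) h.2.2 ∈ D) ∧
      IsInvestment T h.2.1 ∧ ¬ CoolOffBreach T h.2.1
    · convert measurableSet_eval
        (⟨n, a, Fin.take (n + 1) (Nat.succ_le_succ hn) h.2.2⟩ : PrivateHistory X) Act.N using 1
      ext s
      simp only [Set.mem_ofPred_eq]
      exact ⟨fun ⟨_, _, h2, _⟩ => h2, fun h2 => ⟨hn, hc.1, h2, hc.2⟩⟩
    · convert MeasurableSet.empty using 1
      ext s
      simp only [Set.mem_ofPred_eq, Set.mem_empty_iff_false, iff_false]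
      rintro ⟨_, h1, -, h3⟩
      exact hc ⟨h1, h3⟩
  · convert MeasurableSet.empty using 1
    ext s
    simp only [Set.mem_ofPred_eq, Set.mem_empty_iff_false, iff_false]
    rintro ⟨h1, -⟩
    exact hn h1

theorem consistent_deviate_iff {i : Fin 2} {m : ℕ} {a' : ActionHistory m} {x : Fin (m + 1) → X}
    (h : ∀ hn : n < m, Fin.take n hn.le a' = a →
      s ⟨n, a, Fin.take (n + 1) (Nat.succ_le_succ hn.le) x⟩ ≠ Act.N) :
    Consistent i (deviate T a D s) a' x ↔ Consistent i s a' x := by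
  refine forall_congr' fun k => ?_
  rw [deviate_eq_self]
  intro hn
  exact h (hn.trans_lt k.isLt)

/-- The mixed strategy obtained by applying `deviate` to the drawn pure strategy. -/
def deviateMixed (T : ℕ → ℕ) (a : ActionHistory n) (D : Set (Fin (n + 1) → X))
    (σ : MixedStrategy X) : MixedStrategy X :=
  σ.map (measurable_deviate (T := T) (a := a) (D := D)).aemeasurable

theorem mass_deviateMixed [Fintype X] (w : X → ℝ) (σ : MixedStrategy X) {m : ℕ}
    {Q : (Fin (m + 1) → X) → Set (PureStrategy X)} (hQ : ∀ x, MeasurableSet (Q x)) :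
    mass w (deviateMixed T a D σ : Measure (PureStrategy X)) Q =
      mass w (σ : Measure (PureStrategy X)) (fun x => deviate T a D ⁻¹' Q x) := by
  unfold mass deviateMixed
  refine Finset.sum_congr rfl fun x _ => ?_
  rw [ProbabilityMeasure.toMeasure_map, map_measureReal_apply measurable_deviate (hQ x)]

/-- Moving some non-investors at `a` to investing changes the mix of strategies behind later
histories, so the conditional investment frequency could fall for those left behind as well as for
those who join the investors. Having every strategy that chose `N` at `a` invest at all later
investment histories without violations removes the problem: the altered strategies satisfy the
constraint with certainty and the others inherit it. Linearity of the constraint lets the two groups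
be added. -/
theorem deviateMixed_mem [Fintype X] {f : State → PMF X} (hfull : ∀ θ x, f θ x ≠ 0) {ε : ℝ}
    (hε : 0 < ε) {i : Fin 2} {σ : MixedStrategy X} (hσ : σ ∈ coolOffStrategies f T ε i) :
    deviateMixed T a D σ ∈ coolOffStrategies f T ε i := by
  rw [mem_coolOffStrategies_iff hfull] at hσ ⊢
  obtain ⟨hsupp, hcon⟩ := hσ
  have hw := dens_nonneg f State.H
  constructor
  · refine Measure.support_subset_of_isClosed (isClosed_coolOffPure T) ?_
    rw [deviateMixed, ProbabilityMeasure.toMeasure_map]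
    refine (ae_map_iff measurable_deviate.aemeasurable
      (isClosed_coolOffPure T).measurableSet).2 ?_
    filter_upwards [ae_mem_coolOffPure hsupp] with s hs
    exact deviate_mem_coolOffPure hs
  · intro m a' hinv hbr
    have h0 := hcon m a' hinv hbr
    rw [mass_deviateMixed _ _ (measurableSet_consistentSet i a'),
      mass_deviateMixed _ _ (measurableSet_choiceSet i a' Act.I)]
    by_cases hext : ∃ hn : n < m, Fin.take n hn.le a' = a
    · obtain ⟨hn, hext⟩ := hext
      -- `R` collects the strategies that already invest at `a`, which the deviation leaves
      -- unchanged.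
      let R : (Fin (m + 1) → X) → Set (PureStrategy X) := fun x =>
        {s | s ⟨n, a, Fin.take (n + 1) (Nat.succ_le_succ hn.le) x⟩ = Act.I}
      have hR : ∀ x, MeasurableSet (R x) := fun x => measurableSet_eval _ _
      rw [← mass_add_mass_diff _ R hR, ← mass_add_mass_diff (fun x => deviate T a D ⁻¹' _) R hR,
        mul_add]
      have hsame : ∀ x, ∀ s ∈ R x, ∀ hn' : n ≤ m, Fin.take n hn' a' = a →
          s ⟨n, a, Fin.take (n + 1) (Nat.succ_le_succ hn') x⟩ ≠ Act.N := by
        intro x s hs _ _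
        rw [show s ⟨n, a, Fin.take (n + 1) _ x⟩ = Act.I from hs]
        simp
      refine add_le_add ?_ ?_
      · have e1 : ∀ x, deviate T a D ⁻¹' consistentSet i a' x ∩ R x =
            consistentSet i a' x ∩ R x := by
          intro x
          ext s
          refine and_congr_left fun hs => consistent_deviate_iff fun hn' => hsame x s hs hn'.le
        have e2 : ∀ x, deviate T a D ⁻¹' choiceSet i a' Act.I x ∩ R x =
            choiceSet i a' Act.I x ∩ R x := by
          intro x
          ext s
          refine and_congr_left fun hs => and_congr
            (consistent_deviate_iff fun hn' => hsame x s hs hn'.le) ?_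
          rw [deviate_eq_self (hsame x s hs)]
        simp_rw [e1, e2]
        have hact : ∀ x : Fin (m + 1) → X, ∀ s ∈ consistentSet i a' x,
            s ⟨n, a, Fin.take (n + 1) (Nat.succ_le_succ hn.le) x⟩ = a' ⟨n, hn⟩ i := by
          intro x s hs
          have := hs ⟨n, hn⟩
          subst hext
          exact this
        -- If `a'` records an investment at `a`, every original strategy consistent with `a'` lies
        -- in `R`, so the old constraint applies as it is. Otherwise none does, and the claim for
        -- `R` is trivial.
        by_cases hI : a' ⟨n, hn⟩ i = Act.I
        · have e3 : ∀ x, consistentSet i a' x ∩ R x = consistentSet i a' x := fun x =>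
            Set.inter_eq_left.2 fun s hs => (hact x s hs).trans hI
          have e4 : ∀ x, choiceSet i a' Act.I x ∩ R x = choiceSet i a' Act.I x := fun x =>
            Set.inter_eq_left.2 fun s hs => (hact x s hs.1).trans hI
          simp_rw [e3, e4]
          exact h0
        · have e3 : ∀ x, consistentSet i a' x ∩ R x = ∅ := fun x => by
            refine Set.eq_empty_of_forall_notMem fun s hs => hI ?_
            rw [← hact x s hs.1]
            exact hs.2
          have : mass (dens f State.H) (σ : Measure (PureStrategy X))
              (fun x => consistentSet i a' x ∩ R x) = 0 := by
            simp_rw [e3]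
            simp [mass]
          rw [this, mul_zero]
          exact mass_nonneg hw _
      · have hle : mass (dens f State.H) (σ : Measure (PureStrategy X))
            (fun x => deviate T a D ⁻¹' consistentSet i a' x \ R x) ≤
            mass (dens f State.H) (σ : Measure (PureStrategy X))
            (fun x => deviate T a D ⁻¹' choiceSet i a' Act.I x \ R x) := by
          refine mass_mono hw fun x s hs => ⟨⟨hs.1, ?_⟩, hs.2⟩
          exact deviate_eq_I hn.le hext (Act.eq_N_of_ne_I hs.2) (fun h => absurd h hn.ne') hinv hbr
        refine le_trans ?_ hle
        have := mass_nonneg (σ := (σ : Measure (PureStrategy X))) hw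
          (fun x => deviate T a D ⁻¹' consistentSet i a' x \ R x)
        nlinarith
    -- If `a'` does not strictly extend `a`, the past is unaffected, and at `a'` itself the
    -- deviation can only add investment.
    · have e1 : ∀ x, deviate T a D ⁻¹' consistentSet i a' x = consistentSet i a' x := by
        intro x
        ext s
        exact consistent_deviate_iff fun hn h => absurd ⟨hn, h⟩ hext
      simp_rw [e1]
      refine h0.trans (mass_mono hw fun x s hs => ⟨?_, ?_⟩)
      · exact (consistent_deviate_iff fun hn h => absurd ⟨hn, h⟩ hext).2 hs.1
      · exact deviate_eq_I_of_eq_I hs.2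

end Deviation

/-! ### Length of the cool-off phase after a failed investment -/

section CoolOffLength

theorem lastInvest_eq_of_coolOff (T : ℕ → ℕ) {n : ℕ} : ∀ {m : ℕ} (a : ActionHistory m)
    (hn : n < m), m ≤ n + T (n + 1) → IsInvestment T (Fin.take n hn.le a) →
      a ⟨n, hn⟩ ≠ bothInvest → lastInvest T m a = some n := by
  intro m
  induction m with
  | zero => intro a hn; omega
  | succ m ih =>
    intro a hn hm hinv hne
    rw [lastInvest]
    rcases Nat.lt_succ_iff_lt_or_eq.1 hn with h | rfl
    · rw [ih (Fin.init a) h (by omega) hinv hne]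
      simp only
      rw [if_neg h.ne, if_neg (by omega)]
    · have : lastInvest T n (Fin.init a) = some n := hinv
      rw [this]
      simp only [if_true]
      exact if_neg hne

/-- A failure after a history of length `n` freezes play at the lengths `n + 1, …, n + T (n + 1)`.
Payoffs can therefore differ again only from index `n + T (n + 1) + 1` on. -/
theorem isCoolOff_of_le (T : ℕ → ℕ) {n m : ℕ} (a : ActionHistory m) (hn : n < m)
    (hm : m ≤ n + T (n + 1)) (hinv : IsInvestment T (Fin.take n hn.le a))
    (hne : a ⟨n, hn⟩ ≠ bothInvest) : IsCoolOff T a := by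
  rw [IsCoolOff, IsInvestment, lastInvest_eq_of_coolOff T a hn hm hinv hne]
  simpa using hn.ne

end CoolOffLength

/-! ### Bounds on stage payoffs -/

section StagePayoff

variable {c : ℝ} {i j : Fin 2} {b : Profile}

theorem stagePayoff_of_eq_N {θ : State} (h : b i = Act.N) : stagePayoff c i b θ = 0 := by
  simp [stagePayoff, h]

theorem stagePayoff_le (hc : c ∈ Set.Ioo (0 : ℝ) 1) (θ : State) : stagePayoff c i b θ ≤ 1 := by
  unfold stagePayoff
  split_ifs <;> linarith [hc.1]

theorem stagePayoff_L_nonpos (hc : c ∈ Set.Ioo (0 : ℝ) 1) : stagePayoff c i b State.L ≤ 0 := by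
  unfold stagePayoff
  split_ifs with h1 h2
  · exact le_rfl
  · exact absurd h2.2 (by simp)
  · linarith [hc.1]

theorem neg_one_le_stagePayoff (hc : c ∈ Set.Ioo (0 : ℝ) 1) (θ : State) :
    -1 ≤ stagePayoff c i b θ := by
  unfold stagePayoff
  split_ifs <;> linarith [hc.1, hc.2]

theorem eq_bothInvest_iff (hij : i ≠ j) : b = bothInvest ↔ b i = Act.I ∧ b j = Act.I := by
  rw [funext_iff, fin_two_forall hij]
  rfl

end StagePayoff

/-! ### Pathwise comparison of a draw with its deviation -/

section Draws

variable {X : Type*} {n : ℕ}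

/-- The signals and the drawn pure strategies. -/
abbrev Draw (X : Type*) := (ℕ → Fin 2 → X) × (Fin 2 → PureStrategy X)

/-- The actions played after `m` periods. -/
def actions (m : ℕ) (z : Draw X) : Profile :=
  fun k => z.2 k ⟨m, playHistory z.1 z.2 m, signals k m z.1⟩

/-- Player `i`'s drawn pure strategy is replaced by its deviation. -/
def deviateDraw (T : ℕ → ℕ) (a : ActionHistory n) (D : Set (Fin (n + 1) → X)) (i : Fin 2)
    (z : Draw X) : Draw X :=
  (z.1, Function.update z.2 i (deviate T a D (z.2 i)))

/-- The history `a` is reached and player `i` does not invest there. -/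
def missEvent (i : Fin 2) (a : ActionHistory n) : Set (Draw X) :=
  {z | playHistory z.1 z.2 n = a ∧ z.2 i ⟨n, a, signals i n z.1⟩ = Act.N}

/-- The history `a` is reached and player `i` does not invest there in spite of signals in `D`. -/
def missEventOn (i : Fin 2) (a : ActionHistory n) (D : Set (Fin (n + 1) → X)) : Set (Draw X) :=
  {z | z ∈ missEvent i a ∧ signals i n z.1 ∈ D}

variable {T : ℕ → ℕ} {a : ActionHistory n} {D : Set (Fin (n + 1) → X)} {i j : Fin 2} {z : Draw X}

theorem deviateDraw_choice {m : ℕ} (h : z ∉ missEvent i a ∨ m < n) (k : Fin 2) :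
    (deviateDraw T a D i z).2 k ⟨m, playHistory z.1 z.2 m, signals k m z.1⟩ =
      z.2 k ⟨m, playHistory z.1 z.2 m, signals k m z.1⟩ := by
  by_cases hk : k = i
  · subst hk
    simp only [deviateDraw, Function.update_self]
    refine deviate_eq_self fun hn h1 h2 => ?_
    rcases h with h | h
    · rw [take_playHistory] at h1
      exact h ⟨h1, h2⟩
    · omega
  · simp [deviateDraw, Function.update_of_ne hk]

theorem playHistory_deviateDraw {m : ℕ} (h : z ∉ missEvent i a ∨ m ≤ n) :
    playHistory (deviateDraw T a D i z).1 (deviateDraw T a D i z).2 m = playHistory z.1 z.2 m := by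
  induction m with
  | zero => rfl
  | succ m ih =>
    have ih' := ih (h.imp_right fun h => by omega)
    rw [playHistory, playHistory, ih']
    congr 1
    funext k
    exact deviateDraw_choice (h.imp_right fun h => by omega) k

theorem actions_deviateDraw {m : ℕ} (h : z ∉ missEvent i a ∨ m < n) :
    actions m (deviateDraw T a D i z) = actions m z := by
  funext k
  unfold actions
  rw [playHistory_deviateDraw (h.imp_right fun h => by omega)]
  exact deviateDraw_choice h k

theorem take_playHistory_deviateDraw {m : ℕ} (hm : n ≤ m) (hz : playHistory z.1 z.2 n = a) :
    Fin.take n hm (playHistory (deviateDraw T a D i z).1 (deviateDraw T a D i z).2 m) = a := by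
  rw [take_playHistory, playHistory_deviateDraw (Or.inr le_rfl), hz]

theorem actions_eq_N_of_coolOff {m : ℕ} {s : Fin 2 → PureStrategy X} {x : ℕ → Fin 2 → X}
    (hs : s i ∈ coolOffPure X T) (hinv : IsInvestment T a) (ha : playHistory x s n = a)
    (hN : actions n (x, s) i = Act.N) (h1 : n < m) (h2 : m ≤ n + T (n + 1)) :
    actions m (x, s) i = Act.N := by
  refine hs.1 _ _ _ (isCoolOff_of_le T _ h1 h2 ?_ ?_)
  · rw [take_playHistory]
    exact ha ▸ hinv
  · intro h
    rw [playHistory_apply] at h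
    have h' : actions n (x, s) i = Act.I := congrFun h i
    rw [hN] at h'
    cases h'

theorem actions_of_mem_missEvent (hz : z ∈ missEvent i a) : actions n z i = Act.N := by
  obtain ⟨h1, h2⟩ := hz
  unfold actions
  rw [h1]
  exact h2

theorem actions_deviateDraw_of_mem (hz : z ∈ missEvent i a) (hD : z ∉ missEventOn i a D) :
    actions n (deviateDraw T a D i z) i = Act.N := by
  unfold actions
  rw [playHistory_deviateDraw (Or.inr le_rfl), hz.1]
  simp only [deviateDraw, Function.update_self]
  rw [deviate_self_of_notMem fun h => hD ⟨hz, h⟩]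
  exact hz.2

open Classical in
-- The original payoff is nonpositive in the low state and the deviation loses at most 1 per period.
-- A miss with signals in `D` is charged this loss in every period from `n` on. A miss outside `D`
-- remains a miss, so the cool-off phase still occurs and the loss is charged only after it.
theorem stage_diff_L {c : ℝ} (hc : c ∈ Set.Ioo (0 : ℝ) 1) (hz : z.2 i ∈ coolOffPure X T)
    (hinv : IsInvestment T a) (m : ℕ) :
    -(if n ≤ m then (missEventOn i a D).indicator 1 z else 0) -
        (if n + T (n + 1) + 1 ≤ m then (missEvent i a).indicator 1 z else 0) ≤
      stagePayoff c i (actions m (deviateDraw T a D i z)) State.L -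
        stagePayoff c i (actions m z) State.L := by
  have p1 : (0 : ℝ) ≤ if n ≤ m then (missEventOn i a D).indicator 1 z else 0 := by
    split_ifs
    · exact Set.indicator_nonneg (fun _ _ => zero_le_one) _
    · exact le_rfl
  have p2 : (0 : ℝ) ≤ if n + T (n + 1) + 1 ≤ m then (missEvent i a).indicator 1 z else 0 := by
    split_ifs
    · exact Set.indicator_nonneg (fun _ _ => zero_le_one) _
    · exact le_rfl
  by_cases h : z ∉ missEvent i a ∨ m < n
  · rw [actions_deviateDraw h, sub_self]
    linarith
  push Not at h
  obtain ⟨hE, hm⟩ := h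
  have q1 := stagePayoff_L_nonpos (i := i) (b := actions m z) hc
  have q2 := neg_one_le_stagePayoff (i := i) (b := actions m (deviateDraw T a D i z)) hc State.L
  by_cases hEh : z ∈ missEventOn i a D
  · rw [if_pos hm, Set.indicator_of_mem hEh, Pi.one_apply]
    linarith
  by_cases hlate : n + T (n + 1) + 1 ≤ m
  · rw [if_pos hlate, Set.indicator_of_mem hE, Pi.one_apply]
    linarith
  have hN : actions m (deviateDraw T a D i z) i = Act.N := by
    have h0 := actions_deviateDraw_of_mem (T := T) hE hEh
    rcases hm.eq_or_lt with rfl | hm'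
    · exact h0
    · refine actions_eq_N_of_coolOff (a := a) ?_ hinv ?_ h0 hm' (by omega)
      · simp only [Function.update_self]
        exact deviate_mem_coolOffPure hz
      · rw [← hE.1]
        exact playHistory_deviateDraw (Or.inr le_rfl)
  rw [stagePayoff_of_eq_N hN]
  linarith

open Classical in
-- After a miss the original plan earns nothing until the cool-off phase ends and at most 1 per
-- period afterwards. The payoff of the deviation is not bounded pathwise; its sign emerges only
-- after averaging over the opponent.
theorem stage_diff_H {c : ℝ} (hc : c ∈ Set.Ioo (0 : ℝ) 1) (hz : z.2 i ∈ coolOffPure X T)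
    (hinv : IsInvestment T a) (m : ℕ) :
    (if n ≤ m then (missEvent i a).indicator
          (fun z => stagePayoff c i (actions m (deviateDraw T a D i z)) State.H) z else 0) -
        (if n + T (n + 1) + 1 ≤ m then (missEvent i a).indicator 1 z else 0) ≤
      stagePayoff c i (actions m (deviateDraw T a D i z)) State.H -
        stagePayoff c i (actions m z) State.H := by
  by_cases hE : z ∈ missEvent i a
  swap
  · rw [actions_deviateDraw (Or.inl hE), sub_self, Set.indicator_of_notMem hE,
      Set.indicator_of_notMem hE]
    simp
  rw [Set.indicator_of_mem hE, Set.indicator_of_mem hE, Pi.one_apply]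
  by_cases hm : n ≤ m
  swap
  · rw [actions_deviateDraw (Or.inr (by omega)), sub_self, if_neg hm, if_neg (by omega)]
    simp
  rw [if_pos hm]
  have q := stagePayoff_le (i := i) (b := actions m z) hc State.H
  split_ifs with hlate
  · linarith
  · have h0 := actions_of_mem_missEvent hE
    have hN : actions m z i = Act.N := by
      rcases hm.eq_or_lt with rfl | hm'
      · exact h0
      · exact actions_eq_N_of_coolOff hz hinv hE.1 h0 hm' (by omega)
    rw [stagePayoff_of_eq_N hN]

theorem missEventOn_univ (i : Fin 2) (a : ActionHistory n) :
    missEventOn i a (Set.univ : Set (Fin (n + 1) → X)) = missEvent i a := by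
  ext z; simp [missEventOn]

/-- Given signals `x`, the pure strategies that do not invest at `a` and whose deviation is
consistent with `a'` and invests there. -/
def lateInvest (T : ℕ → ℕ) (a : ActionHistory n) (D : Set (Fin (n + 1) → X)) (i : Fin 2) {m : ℕ}
    (hm : n ≤ m) (a' : ActionHistory m) (x : Fin (m + 1) → X) : Set (PureStrategy X) :=
  {s | (Fin.take n hm a' = a ∧ s ⟨n, a, Fin.take (n + 1) (Nat.succ_le_succ hm) x⟩ = Act.N) ∧
    deviate T a D s ∈ choiceSet i a' Act.I x}

theorem measurableSet_lateInvest {m : ℕ} (hm : n ≤ m) (a' : ActionHistory m)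
    (x : Fin (m + 1) → X) : MeasurableSet (lateInvest T a D i hm a' x) :=
  ((MeasurableSet.const _).inter (measurableSet_eval _ _)).inter
    (measurable_deviate (measurableSet_choiceSet i a' Act.I x))

open Classical in
/-- The draws at which player `i`'s deviation belongs to `lateInvest` and the opponent's strategy
belongs to `Q`. -/
def lateDraw (T : ℕ → ℕ) (a : ActionHistory n) (D : Set (Fin (n + 1) → X)) (i : Fin 2) {m : ℕ}
    (hm : n ≤ m) (a' : ActionHistory m)
    (Q : Fin 2 → (Fin (m + 1) → X) → Set (PureStrategy X)) : Set (Draw X) :=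
  {z | ∀ k, z.2 k ∈ (if k = i then lateInvest T a D i hm a' else Q k) (signals k m z.1)}

theorem mem_lateDraw_iff (hij : i ≠ j) {m : ℕ} (hm : n ≤ m) (a' : ActionHistory m)
    (Q : Fin 2 → (Fin (m + 1) → X) → Set (PureStrategy X)) :
    z ∈ lateDraw T a D i hm a' Q ↔ z.2 i ∈ lateInvest T a D i hm a' (signals i m z.1) ∧
      z.2 j ∈ Q j (signals j m z.1) := by
  unfold lateDraw
  rw [Set.mem_ofPred_eq, fin_two_forall hij, if_pos rfl, if_neg hij.symm]

theorem playHistory_eq_of_mem_lateDraw (hij : i ≠ j) {m : ℕ} (hm : n ≤ m) (a' : ActionHistory m)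
    (h : z ∈ lateDraw T a D i hm a' (fun k => consistentSet k a')) :
    playHistory (deviateDraw T a D i z).1 (deviateDraw T a D i z).2 m = a' := by
  rw [mem_lateDraw_iff hij] at h
  rw [playHistory_eq_iff, fin_two_forall hij]
  simp only [deviateDraw, Function.update_self, Function.update_of_ne hij.symm]
  exact ⟨h.1.2.1, h.2⟩

/-- In the high state the payoff is `1{both invest} - c · 1{i invests}`. Sorting by the history `a'`
that the deviation reaches turns both events into one condition on player `i` and one on the
opponent, so that independence applies. -/
theorem stage_indicator_eq (hij : i ≠ j) {c : ℝ} {m : ℕ} (hm : n ≤ m) (z : Draw X) :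
    (missEvent i a).indicator
      (fun z => stagePayoff c i (actions m (deviateDraw T a D i z)) State.H) z =
    ∑ a' : ActionHistory m,
      ((lateDraw T a D i hm a' (fun k => choiceSet k a' Act.I)).indicator 1 z -
        c * (lateDraw T a D i hm a' (fun k => consistentSet k a')).indicator 1 z) := by
  have hsub : ∀ a' : ActionHistory m,
      z ∈ lateDraw T a D i hm a' (fun k => choiceSet k a' Act.I) →
        z ∈ lateDraw T a D i hm a' (fun k => consistentSet k a') := by
    intro a' h
    rw [mem_lateDraw_iff hij] at h ⊢
    exact ⟨h.1, h.2.1⟩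
  have hzero : ∀ a' : ActionHistory m,
      z ∉ lateDraw T a D i hm a' (fun k => consistentSet k a') →
      ((lateDraw T a D i hm a' (fun k => choiceSet k a' Act.I)).indicator 1 z -
        c * (lateDraw T a D i hm a' (fun k => consistentSet k a')).indicator 1 z) = 0 := by
    intro a' h
    rw [Set.indicator_of_notMem h, Set.indicator_of_notMem fun h' => h (hsub a' h')]
    simp
  by_cases hE : z ∈ missEvent i a
  swap
  · rw [Set.indicator_of_notMem hE, Finset.sum_eq_zero]
    intro a' _
    refine hzero a' fun h => hE ?_
    have hp := playHistory_eq_of_mem_lateDraw hij hm a' h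
    rw [mem_lateDraw_iff hij] at h
    obtain ⟨⟨⟨h1, h2⟩, -⟩, -⟩ := h
    rw [← hp, take_playHistory, playHistory_deviateDraw (Or.inr le_rfl)] at h1
    exact ⟨h1, h2⟩
  set a₀ := playHistory (deviateDraw T a D i z).1 (deviateDraw T a D i z).2 m with ha₀
  rw [Set.indicator_of_mem hE, Finset.sum_eq_single a₀]
  · have hcon := (playHistory_eq_iff (deviateDraw T a D i z).1 (deviateDraw T a D i z).2 a₀).1
      ha₀.symm
    rw [fin_two_forall hij] at hcon
    have hcon_i : Consistent i (deviate T a D (z.2 i)) a₀ (signals i m z.1) := by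
      have := hcon.1
      simp only [deviateDraw, Function.update_self] at this
      exact this
    have hcon_j : Consistent j (z.2 j) a₀ (signals j m z.1) := by
      have := hcon.2
      simp only [deviateDraw, Function.update_of_ne hij.symm] at this
      exact this
    have htake : Fin.take n hm a₀ = a := take_playHistory_deviateDraw hm hE.1
    have hact_i : actions m (deviateDraw T a D i z) i =
        deviate T a D (z.2 i) ⟨m, a₀, signals i m z.1⟩ := by
      unfold actions
      rw [← ha₀]
      simp [deviateDraw]
    have hact_j : actions m (deviateDraw T a D i z) j = z.2 j ⟨m, a₀, signals j m z.1⟩ := by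
      unfold actions
      rw [← ha₀]
      simp [deviateDraw, Function.update_of_ne hij.symm]
    have hC : z ∈ lateDraw T a D i hm a₀ (fun k => consistentSet k a₀) ↔
        actions m (deviateDraw T a D i z) i = Act.I := by
      rw [mem_lateDraw_iff hij, hact_i]
      exact ⟨fun h => h.1.2.2, fun h => ⟨⟨⟨htake, hE.2⟩, hcon_i, h⟩, hcon_j⟩⟩
    have hI : z ∈ lateDraw T a D i hm a₀ (fun k => choiceSet k a₀ Act.I) ↔
        actions m (deviateDraw T a D i z) = bothInvest := by
      rw [mem_lateDraw_iff hij, eq_bothInvest_iff hij, hact_i, hact_j]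
      exact ⟨fun h => ⟨h.1.2.2, h.2.2⟩,
        fun h => ⟨⟨⟨htake, hE.2⟩, hcon_i, h.1⟩, hcon_j, h.2⟩⟩
    by_cases h1 : actions m (deviateDraw T a D i z) i = Act.I
    · rw [Set.indicator_of_mem (hC.2 h1)]
      by_cases h2 : actions m (deviateDraw T a D i z) = bothInvest
      · rw [Set.indicator_of_mem (hI.2 h2), stagePayoff, if_neg (by simp [h1]),
          if_pos ⟨h2, rfl⟩]
        simp
      · rw [Set.indicator_of_notMem (hI.not.2 h2), stagePayoff, if_neg (by simp [h1]),
          if_neg fun h => h2 h.1]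
        simp
    · rw [hzero a₀ (hC.not.2 h1), stagePayoff_of_eq_N (Act.eq_N_of_ne_I h1)]
  · intro a' _ hne
    exact hzero a' fun h => hne (playHistory_eq_of_mem_lateDraw hij hm a' h).symm
  · simp

end Draws

/-! ### Probabilities of missed and late investments -/

section Integrals

variable {X : Type*} [MeasurableSpace X] [Fintype X] [DiscreteMeasurableSpace X] {n : ℕ}
  {T : ℕ → ℕ} {a : ActionHistory n} {D : Set (Fin (n + 1) → X)} {i j : Fin 2}

open Classical in
theorem measurableSet_lateDraw {m : ℕ} (hm : n ≤ m) (a' : ActionHistory m)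
    {Q : Fin 2 → (Fin (m + 1) → X) → Set (PureStrategy X)} (hQ : ∀ k x, MeasurableSet (Q k x)) :
    MeasurableSet (lateDraw T a D i hm a' Q) := by
  refine measurableSet_draw
    (Q := fun k => if k = i then lateInvest T a D i hm a' else Q k) fun k x => ?_
  split_ifs
  · exact measurableSet_lateInvest hm a' x
  · exact hQ k x

open Classical in
theorem drawLaw_lateDraw (f : State → PMF X) (σ : Fin 2 → MixedStrategy X) (θ : State)
    (hij : i ≠ j) {m : ℕ} (hm : n ≤ m) (a' : ActionHistory m)
    {Q : Fin 2 → (Fin (m + 1) → X) → Set (PureStrategy X)} (hQ : ∀ k x, MeasurableSet (Q k x)) :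
    (drawLaw f σ θ).real (lateDraw T a D i hm a' Q) =
      mass (dens f θ) (σ i : Measure (PureStrategy X)) (lateInvest T a D i hm a') *
        mass (dens f θ) (σ j : Measure (PureStrategy X)) (Q j) := by
  unfold lateDraw
  rw [drawLaw_real f σ θ (fun k => if k = i then lateInvest T a D i hm a' else Q k),
    fin_two_prod hij, if_pos rfl, if_neg hij.symm]
  intro k x
  split_ifs
  · exact measurableSet_lateInvest hm a' x
  · exact hQ k x

theorem integral_stage_missEvent (f : State → PMF X) (σ : Fin 2 → MixedStrategy X) (hij : i ≠ j)
    {c : ℝ} {m : ℕ} (hm : n ≤ m) :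
    ∫ z, (missEvent i a).indicator
      (fun z => stagePayoff c i (actions m (deviateDraw T a D i z)) State.H) z
        ∂(drawLaw f σ State.H) =
    ∑ a' : ActionHistory m,
      mass (dens f State.H) (σ i : Measure (PureStrategy X)) (lateInvest T a D i hm a') *
        (mass (dens f State.H) (σ j : Measure (PureStrategy X)) (choiceSet j a' Act.I) -
          c * reach (dens f State.H) σ j a') := by
  have m1 : ∀ a' : ActionHistory m,
      MeasurableSet (lateDraw T a D i hm a' (fun k => choiceSet k a' Act.I)) := fun a' =>
    measurableSet_lateDraw hm a' fun k x => measurableSet_choiceSet k a' Act.I x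
  have m2 : ∀ a' : ActionHistory m,
      MeasurableSet (lateDraw T a D i hm a' (fun k => consistentSet k a')) := fun a' =>
    measurableSet_lateDraw hm a' fun k x => measurableSet_consistentSet k a' x
  have i1 : ∀ S : Set (Draw X), MeasurableSet S →
      Integrable (S.indicator (1 : Draw X → ℝ)) (drawLaw f σ State.H) := fun S hS =>
    (integrable_const (1 : ℝ)).indicator hS
  simp_rw [stage_indicator_eq hij hm]
  refine (integral_finsetSum _ fun a' _ => (i1 _ (m1 a')).sub ((i1 _ (m2 a')).const_mul c)).trans ?_
  refine Finset.sum_congr rfl fun a' _ => ?_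
  rw [integral_sub' (i1 _ (m1 a')) ((i1 _ (m2 a')).const_mul c), integral_const_mul,
    integral_indicator_one (m1 a'), integral_indicator_one (m2 a'),
    drawLaw_lateDraw f σ State.H hij hm a' fun k x => measurableSet_choiceSet k a' Act.I x,
    drawLaw_lateDraw f σ State.H hij hm a' fun k x => measurableSet_consistentSet k a' x]
  unfold reach
  ring

theorem measurableSet_missEventOn (i : Fin 2) (a : ActionHistory n)
    (D : Set (Fin (n + 1) → X)) : MeasurableSet (missEventOn i a D) := by
  have e : missEventOn i a D =
      {z : Draw X | playHistory z.1 z.2 n = a} ∩ {z | z.2 i ∈ (fun x => {s | x ∈ D ∧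
        s ⟨n, a, x⟩ = Act.N} : (Fin (n + 1) → X) → Set (PureStrategy X)) (signals i n z.1)} := by
    ext z
    simp only [missEventOn, missEvent, Set.mem_ofPred_eq, Set.mem_inter_iff]
    tauto
  rw [e]
  refine (measurableSet_eq_fun (measurable_play n).1 measurable_const).inter ?_
  have := measurableSet_draw (X := X) (n := n) (Q := fun k x => {s | k = i → (x ∈ D ∧
        s ⟨n, a, x⟩ = Act.N)}) fun k x => by
    by_cases hk : k = i
    · simp only [hk, true_imp_iff]
      exact (MeasurableSet.const _).inter (measurableSet_eval _ _)
    · simp [hk]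
  convert this using 1
  ext z
  simp

theorem measurableSet_missEvent (i : Fin 2) (a : ActionHistory n) :
    MeasurableSet (missEvent (X := X) i a) :=
  missEventOn_univ (X := X) i a ▸ measurableSet_missEventOn i a Set.univ

theorem drawLaw_missEventOn (f : State → PMF X) (σ : Fin 2 → MixedStrategy X) (θ : State)
    (hij : i ≠ j) (a : ActionHistory n) (D : Set (Fin (n + 1) → X)) :
    (drawLaw f σ θ).real (missEventOn i a D) =
      mass (dens f θ) (σ i : Measure (PureStrategy X))
        (fun x => consistentSet i a x ∩ {s | x ∈ D ∧ s ⟨n, a, x⟩ = Act.N}) *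
        reach (dens f θ) σ j a := by
  rw [← drawLaw_history f σ θ a hij (fun x => {s | x ∈ D ∧ s ⟨n, a, x⟩ = Act.N})
    fun x => (MeasurableSet.const _).inter (measurableSet_eval _ _)]
  congr 1
  ext z
  simp only [missEventOn, missEvent, Set.mem_ofPred_eq]
  tauto

end Integrals

/-! ### Discounted sums -/

instance : Finite State :=
  Finite.of_injective (fun θ : State => (match θ with | .H => true | .L => false : Bool))
    (by intro a b h; cases a <;> cases b <;> simp_all)

theorem hasSum_discounted_tail {δ : ℝ} (hδ : δ ∈ Set.Ioo (0 : ℝ) 1) (k : ℕ) (A : ℝ) :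
    HasSum (fun m => (1 - δ) * δ ^ m * (if k ≤ m then A else 0)) (δ ^ k * A) := by
  rw [← hasSum_nat_add_iff' k]
  have h0 : ∑ m ∈ Finset.range k, (1 - δ) * δ ^ m * (if k ≤ m then A else 0) = 0 :=
    Finset.sum_eq_zero fun m hm => by
      rw [if_neg (by simpa using hm), mul_zero]
  have h1 := (hasSum_geometric_of_lt_one hδ.1.le hδ.2).mul_left ((1 - δ) * δ ^ k * A)
  have hne : 1 - δ ≠ 0 := by linarith [hδ.2]
  have e1 : (fun m => (1 - δ) * δ ^ (m + k) * (if k ≤ m + k then A else 0)) =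
      fun m => (1 - δ) * δ ^ k * A * δ ^ m := by
    funext m
    rw [if_pos (by omega), pow_add]
    ring
  have e2 : δ ^ k * A = (1 - δ) * δ ^ k * A * (1 - δ)⁻¹ := by field_simp
  rw [h0, sub_zero, e1, e2]
  exact h1

theorem hasSum_discounted_single (δ : ℝ) (n : ℕ) (A : ℝ) :
    HasSum (fun m => (1 - δ) * δ ^ m * (if m = n then A else 0)) ((1 - δ) * δ ^ n * A) := by
  convert hasSum_ite_eq n ((1 - δ) * δ ^ n * A) using 1
  funext m
  split_ifs with h
  · rw [h]
  · rw [mul_zero]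

/-! ### Payoff effect of the deviation and the equilibrium inequality -/

section Payoff

variable {X : Type*} [MeasurableSpace X] [Fintype X] [DiscreteMeasurableSpace X]

theorem measurable_actions (m : ℕ) : Measurable (actions (X := X) m) :=
  measurable_pi_iff.2 ((measurable_play m).2)

theorem measurable_stagePayoff (c : ℝ) (i : Fin 2) (θ : State) :
    Measurable fun b : Profile => stagePayoff c i b θ :=
  measurable_of_countable _

theorem abs_stagePayoff_le {c : ℝ} (hc : c ∈ Set.Ioo (0 : ℝ) 1) (i : Fin 2) (b : Profile)
    (θ : State) : |stagePayoff c i b θ| ≤ 1 :=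
  abs_le.2 ⟨neg_one_le_stagePayoff hc θ, stagePayoff_le hc θ⟩

theorem integrable_stagePayoff {c : ℝ} (hc : c ∈ Set.Ioo (0 : ℝ) 1) (i : Fin 2) (θ : State)
    {Ω : Type*} [MeasurableSpace Ω] (μ : Measure Ω) [IsFiniteMeasure μ] {g : Ω → Profile}
    (hg : Measurable g) : Integrable (fun ω => stagePayoff c i (g ω) θ) μ :=
  Integrable.of_bound ((measurable_stagePayoff c i θ).comp hg).aestronglyMeasurable 1
    (Filter.Eventually.of_forall fun ω => abs_stagePayoff_le hc i (g ω) θ)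

/-- The expected discounted payoff in state `θ`. -/
def statePayoff (f : State → PMF X) (c δ : ℝ) (σ : Fin 2 → MixedStrategy X) (i : Fin 2)
    (θ : State) : ℝ :=
  ∫ z, discountedPayoff c δ i (outcome θ z) ∂(drawLaw f σ θ)

theorem hasSum_statePayoff {c δ : ℝ} (hc : c ∈ Set.Ioo (0 : ℝ) 1) (hδ : δ ∈ Set.Ioo (0 : ℝ) 1)
    (f : State → PMF X) (σ : Fin 2 → MixedStrategy X) (i : Fin 2) (θ : State) :
    HasSum (fun m => (1 - δ) * δ ^ m * ∫ z, stagePayoff c i (actions m z) θ ∂(drawLaw f σ θ))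
      (statePayoff f c δ σ i θ) := by
  have h1 : ∀ m : ℕ, (0 : ℝ) ≤ (1 - δ) * δ ^ m := fun m =>
    mul_nonneg (by linarith [hδ.2]) (pow_nonneg hδ.1.le m)
  have hi : ∀ m, Integrable (fun z => stagePayoff c i (actions m z) θ) (drawLaw f σ θ) := fun m =>
    integrable_stagePayoff hc i θ _ (measurable_actions m)
  have h := hasSum_integral_of_summable_integral_norm (μ := drawLaw f σ θ)
    (F := fun m z => (1 - δ) * δ ^ m * stagePayoff c i (actions m z) θ)
    (fun m => (hi m).const_mul _) (by
      refine Summable.of_nonneg_of_le (fun m => integral_nonneg fun z => norm_nonneg _) (fun m => ?_)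
        ((summable_geometric_of_lt_one hδ.1.le hδ.2).mul_left (1 - δ))
      calc ∫ z, ‖(1 - δ) * δ ^ m * stagePayoff c i (actions m z) θ‖ ∂(drawLaw f σ θ)
          ≤ ∫ _z, (1 - δ) * δ ^ m ∂(drawLaw f σ θ) := by
            refine integral_mono ((hi m).const_mul _).norm (integrable_const _) fun z => ?_
            simp only
            rw [norm_mul, Real.norm_of_nonneg (h1 m)]
            exact mul_le_of_le_one_right (h1 m) (abs_stagePayoff_le hc i _ θ)
        _ = (1 - δ) * δ ^ m := by simp)
  simp_rw [integral_const_mul] at h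
  exact h

theorem measurable_discountedPayoff {c δ : ℝ} (hc : c ∈ Set.Ioo (0 : ℝ) 1)
    (hδ : δ ∈ Set.Ioo (0 : ℝ) 1) (i : Fin 2) : Measurable (discountedPayoff (X := X) c δ i) := by
  have hterm : ∀ m : ℕ, Measurable fun ω : Outcome X =>
      (1 - δ) * δ ^ m * stagePayoff c i (ω.2.2 m) ω.1 := by
    intro m
    refine Measurable.const_mul ?_ _
    have : Measurable fun q : Profile × State => stagePayoff c i q.1 q.2 :=
      measurable_from_prod_countable_left fun θ => measurable_stagePayoff c i θ
    have hq : Measurable fun ω : Outcome X => (ω.2.2 m, ω.1) := by fun_prop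
    exact this.comp hq
  refine measurable_of_tendsto_metrizable (f := fun N ω => ∑ m ∈ Finset.range N,
    (1 - δ) * δ ^ m * stagePayoff c i (ω.2.2 m) ω.1)
    (fun N => Finset.measurable_fun_sum _ fun m _ => hterm m) ?_
  refine tendsto_pi_nhds.2 fun ω => HasSum.tendsto_sum_nat (Summable.hasSum ?_)
  refine Summable.of_norm_bounded
    ((summable_geometric_of_lt_one hδ.1.le hδ.2).mul_left (1 - δ)) fun m => ?_
  have h1 : (0 : ℝ) ≤ (1 - δ) * δ ^ m := mul_nonneg (by linarith [hδ.2]) (pow_nonneg hδ.1.le m)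
  rw [norm_mul, Real.norm_of_nonneg h1]
  exact mul_le_of_le_one_right h1 (abs_stagePayoff_le hc i _ _)

theorem abs_discountedPayoff_le {c δ : ℝ} (hc : c ∈ Set.Ioo (0 : ℝ) 1)
    (hδ : δ ∈ Set.Ioo (0 : ℝ) 1) (i : Fin 2) (ω : Outcome X) :
    ‖discountedPayoff c δ i ω‖ ≤ 1 := by
  have hs : HasSum (fun m : ℕ => (1 - δ) * δ ^ m) 1 := by
    simpa using hasSum_discounted_tail hδ 0 1
  refine tsum_of_norm_bounded hs fun m => ?_
  have h1 : (0 : ℝ) ≤ (1 - δ) * δ ^ m := mul_nonneg (by linarith [hδ.2]) (pow_nonneg hδ.1.le m)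
  rw [norm_mul, Real.norm_of_nonneg h1]
  exact mul_le_of_le_one_right h1 (abs_stagePayoff_le hc i _ _)

theorem expectedPayoff_eq {p₀ c δ : ℝ} (hp₀ : p₀ ∈ Set.Ioo (0 : ℝ) 1) (hc : c ∈ Set.Ioo (0 : ℝ) 1)
    (hδ : δ ∈ Set.Ioo (0 : ℝ) 1) (f : State → PMF X) (σ : Fin 2 → MixedStrategy X) (i : Fin 2) :
    expectedPayoff p₀ f c δ σ i =
      p₀ * statePayoff f c δ σ i State.H + (1 - p₀) * statePayoff f c δ σ i State.L := by
  have hm := measurable_discountedPayoff (X := X) hc hδ i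
  have hint : ∀ θ, Integrable (discountedPayoff c δ i)
      ((drawLaw f σ θ).map (outcome θ)) := fun θ => by
    have : IsProbabilityMeasure ((drawLaw f σ θ).map (outcome θ)) :=
      Measure.isProbabilityMeasure_map (measurable_outcome θ).aemeasurable
    exact Integrable.of_bound hm.aestronglyMeasurable 1
      (Filter.Eventually.of_forall (abs_discountedPayoff_le hc hδ i))
  rw [expectedPayoff, outcomeLaw, integral_add_measure
    ((hint _).smul_measure ENNReal.ofReal_ne_top) ((hint _).smul_measure ENNReal.ofReal_ne_top),
    integral_smul_measure, integral_smul_measure,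
    integral_map (measurable_outcome _).aemeasurable hm.aestronglyMeasurable,
    integral_map (measurable_outcome _).aemeasurable hm.aestronglyMeasurable,
    ENNReal.toReal_ofReal hp₀.1.le, ENNReal.toReal_ofReal (by linarith [hp₀.2])]
  rfl

variable {n : ℕ} {T : ℕ → ℕ} {a : ActionHistory n} {D : Set (Fin (n + 1) → X)} {i j : Fin 2}

theorem deviateDraw_eq (i : Fin 2) : deviateDraw T a D i = Prod.map id
    (fun s k => (if k = i then deviate T a D else id) (s k)) := by
  funext z
  refine Prod.ext rfl (funext fun k => ?_)
  by_cases hk : k = i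
  · subst hk; simp [deviateDraw]
  · simp [deviateDraw, hk]

theorem measurable_deviateDraw (i : Fin 2) : Measurable (deviateDraw T a D i) := by
  refine measurable_fst.prodMk (measurable_pi_iff.2 fun k => ?_)
  by_cases hk : k = i
  · subst hk
    simp only [Function.update_self]
    exact measurable_deviate.comp ((measurable_pi_apply k).comp measurable_snd)
  · simp only [Function.update_of_ne hk]
    exact (measurable_pi_apply k).comp measurable_snd

/-- A coupling: the deviating profile is realized on the original draws by altering only player
`i`'s drawn strategy, so payoffs can be compared draw by draw. -/
theorem drawLaw_update (f : State → PMF X) (σ : Fin 2 → MixedStrategy X) (i : Fin 2) (θ : State) :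
    drawLaw f (Function.update σ i (deviateMixed T a D (σ i))) θ =
      (drawLaw f σ θ).map (deviateDraw T a D i) := by
  have hg : ∀ k : Fin 2, Measurable (if k = i then deviate T a D else id) := fun k => by
    split_ifs
    · exact measurable_deviate
    · exact measurable_id
  have hsf : ∀ k : Fin 2, SigmaFinite ((σ k : Measure (PureStrategy X)).map
      (if k = i then deviate T a D else id)) := fun k =>
    have := Measure.isProbabilityMeasure_map (μ := (σ k : Measure (PureStrategy X)))
      (hg k).aemeasurable
    inferInstance
  have hpi := Measure.pi_map_pi (μ := fun k => (σ k : Measure (PureStrategy X)))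
    (f := fun k => if k = i then deviate T a D else id) fun k => (hg k).aemeasurable
  have hmeas : Measurable fun (s : Fin 2 → PureStrategy X) k =>
      (if k = i then deviate T a D else id) (s k) :=
    measurable_pi_iff.2 fun k => (hg k).comp (measurable_pi_apply k)
  unfold drawLaw
  rw [deviateDraw_eq, ← Measure.map_prod_map _ _ measurable_id hmeas, Measure.map_id, hpi]
  congr 2
  funext k
  by_cases hk : k = i
  · subst hk
    simp [deviateMixed]
  · simp [hk]

theorem integral_actions_update (f : State → PMF X) (σ : Fin 2 → MixedStrategy X) (i : Fin 2)
    (θ : State) (c : ℝ) (m : ℕ) :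
    ∫ z, stagePayoff c i (actions m z) θ
        ∂(drawLaw f (Function.update σ i (deviateMixed T a D (σ i))) θ) =
      ∫ z, stagePayoff c i (actions m (deviateDraw T a D i z)) θ ∂(drawLaw f σ θ) := by
  rw [drawLaw_update]
  exact integral_map (measurable_deviateDraw i).aemeasurable
    ((measurable_stagePayoff c i θ).comp (measurable_actions m)).aestronglyMeasurable

theorem ae_drawLaw_coolOffPure {f : State → PMF X} {σ : Fin 2 → MixedStrategy X}
    (h : (σ i : Measure (PureStrategy X)).support ⊆ coolOffPure X T) (θ : State) :
    ∀ᵐ z ∂(drawLaw f σ θ), z.2 i ∈ coolOffPure X T := by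
  have h1 : MeasurePreserving (fun z : Draw X => z.2) (drawLaw f σ θ)
      (Measure.pi fun i => (σ i : Measure (PureStrategy X))) := measurePreserving_snd
  have h2 := (measurePreserving_eval (fun i => (σ i : Measure (PureStrategy X))) i).comp h1
  exact h2.quasiMeasurePreserving.ae (ae_mem_coolOffPure h)

theorem mass_lateInvest_eq_zero {σ : MixedStrategy X}
    (h : (σ : Measure (PureStrategy X)).support ⊆ coolOffPure X T) (w : X → ℝ) {m : ℕ}
    (hm : n ≤ m) {a' : ActionHistory m} (ha' : IsCoolOff T a' ∨ CoolOffBreach T a') :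
    mass w (σ : Measure (PureStrategy X)) (lateInvest T a D i hm a') = 0 := by
  refine Finset.sum_eq_zero fun x _ => ?_
  have : (σ : Measure (PureStrategy X)) (lateInvest T a D i hm a' x) = 0 := by
    refine measure_mono_null (fun s hs => ?_) (ae_iff.1 (ae_mem_coolOffPure h))
    intro hS
    have hI : deviate T a D s ⟨m, a', x⟩ = Act.I := hs.2.2
    have hN : deviate T a D s ⟨m, a', x⟩ = Act.N := by
      rcases ha' with h | h
      · exact (deviate_mem_coolOffPure hS).1 m a' x h
      · exact (deviate_mem_coolOffPure hS).2 m a' x h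
    rw [hI] at hN
    cases hN
  rw [measureReal_def, this, ENNReal.toReal_zero, mul_zero]

/-- Given `H` and a history, the opponent's action is independent of player `i`'s signals and
strategy. The constraint on `σ j` alone thus makes every investment by the deviator worth at least
`1 - ε - c ≥ 0` in expectation. Histories at which investing is forbidden carry no weight, so every
term is nonnegative. -/
theorem integral_stage_missEvent_ge {f : State → PMF X} (hfull : ∀ θ x, f θ x ≠ 0)
    {σ : Fin 2 → MixedStrategy X} (hij : i ≠ j) {c ε : ℝ} (hcε : 0 ≤ 1 - ε - c)
    (hσ : ∀ k, σ k ∈ coolOffStrategies f T ε k) (hinv : IsInvestment T a)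
    (hbr : ¬ CoolOffBreach T a) {m : ℕ} (hm : n ≤ m) :
    (if m = n then (1 - ε - c) * (drawLaw f σ State.H).real (missEventOn i a D) else 0) ≤
    ∫ z, (missEvent i a).indicator
      (fun z => stagePayoff c i (actions m (deviateDraw T a D i z)) State.H) z
        ∂(drawLaw f σ State.H) := by
  have hw := dens_nonneg f State.H
  have hG : ∀ {k : ℕ} (a' : ActionHistory k), IsInvestment T a' → ¬ CoolOffBreach T a' →
      (1 - ε - c) * reach (dens f State.H) σ j a' ≤
        mass (dens f State.H) (σ j : Measure (PureStrategy X)) (choiceSet j a' Act.I) -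
          c * reach (dens f State.H) σ j a' := fun a' h1 h2 => by
    have := ((mem_coolOffStrategies_iff hfull T ε j (σ j)).1 (hσ j)).2 _ a' h1 h2
    unfold reach
    linarith
  have hterm : ∀ a' : ActionHistory m, 0 ≤
      mass (dens f State.H) (σ i : Measure (PureStrategy X)) (lateInvest T a D i hm a') *
        (mass (dens f State.H) (σ j : Measure (PureStrategy X)) (choiceSet j a' Act.I) -
          c * reach (dens f State.H) σ j a') := by
    intro a'
    by_cases h : IsCoolOff T a' ∨ CoolOffBreach T a'
    · rw [mass_lateInvest_eq_zero (hσ i).1 _ hm h, zero_mul]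
    · push Not at h
      have h1 : IsInvestment T a' := not_not.1 h.1
      exact mul_nonneg (mass_nonneg hw _)
        ((mul_nonneg hcε (mass_nonneg hw _)).trans (hG a' h1 h.2))
  rw [integral_stage_missEvent f σ hij hm]
  split_ifs with hmn
  · subst hmn
    -- At time `n` the term `a' = a` contains every miss with signals in `D`, all of which become
    -- investments.
    refine le_trans ?_ (Finset.single_le_sum (fun a' _ => hterm a') (Finset.mem_univ a))
    rw [drawLaw_missEventOn f σ State.H hij]
    have hmono : mass (dens f State.H) (σ i : Measure (PureStrategy X))
        (fun x => consistentSet i a x ∩ {s | x ∈ D ∧ s ⟨m, a, x⟩ = Act.N}) ≤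
        mass (dens f State.H) (σ i : Measure (PureStrategy X)) (lateInvest T a D i hm a) := by
      refine mass_mono hw fun x s hs => ?_
      obtain ⟨h1, h2, h3⟩ := hs
      exact ⟨⟨rfl, h3⟩, (consistent_deviate_iff fun h => absurd h (lt_irrefl _)).2 h1,
        deviate_eq_I hm rfl h3 (fun _ => h2) hinv hbr⟩
    calc _ = mass (dens f State.H) (σ i : Measure (PureStrategy X))
            (fun x => consistentSet i a x ∩ {s | x ∈ D ∧ s ⟨m, a, x⟩ = Act.N}) *
          ((1 - ε - c) * reach (dens f State.H) σ j a) := by ring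
      _ ≤ mass (dens f State.H) (σ i : Measure (PureStrategy X)) (lateInvest T a D i hm a) *
          ((1 - ε - c) * reach (dens f State.H) σ j a) :=
        mul_le_mul_of_nonneg_right hmono (mul_nonneg hcε (mass_nonneg hw _))
      _ ≤ _ := mul_le_mul_of_nonneg_left (hG a hinv hbr) (mass_nonneg hw _)
  · exact Finset.sum_nonneg fun a' _ => hterm a'

open Classical in
theorem statePayoff_update_L {f : State → PMF X} {σ : Fin 2 → MixedStrategy X} {c δ ε : ℝ}
    (hc : c ∈ Set.Ioo (0 : ℝ) 1) (hδ : δ ∈ Set.Ioo (0 : ℝ) 1)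
    (hσ : σ i ∈ coolOffStrategies f T ε i) (hinv : IsInvestment T a) :
    -(δ ^ n * (drawLaw f σ State.L).real (missEventOn i a D)) -
        δ ^ (n + T (n + 1) + 1) * (drawLaw f σ State.L).real (missEvent i a) ≤
      statePayoff f c δ (Function.update σ i (deviateMixed T a D (σ i))) i State.L -
        statePayoff f c δ σ i State.L := by
  have h1 := hasSum_statePayoff hc hδ f (Function.update σ i (deviateMixed T a D (σ i))) i State.L
  have h2 := hasSum_statePayoff hc hδ f σ i State.L
  have b1 := hasSum_discounted_tail hδ n ((drawLaw f σ State.L).real (missEventOn i a D))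
  have b2 := hasSum_discounted_tail hδ (n + T (n + 1) + 1)
    ((drawLaw f σ State.L).real (missEvent i a))
  refine hasSum_le (fun m => ?_) (b1.neg.sub b2) (h1.sub h2)
  have i1 : ∀ S : Set (Draw X), MeasurableSet S →
      Integrable (S.indicator (1 : Draw X → ℝ)) (drawLaw f σ State.L) := fun S hS =>
    (integrable_const (1 : ℝ)).indicator hS
  have iA : Integrable (fun z => if n ≤ m then (missEventOn i a D).indicator (1 : Draw X → ℝ) z
      else 0) (drawLaw f σ State.L) := by
    split_ifs
    · exact i1 _ (measurableSet_missEventOn i a D)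
    · exact integrable_zero _ _ _
  have iB : Integrable (fun z => if n + T (n + 1) + 1 ≤ m then
      (missEvent i a).indicator (1 : Draw X → ℝ) z else 0) (drawLaw f σ State.L) := by
    split_ifs
    · exact i1 _ (measurableSet_missEvent i a)
    · exact integrable_zero _ _ _
  have iu := integrable_stagePayoff hc i State.L (drawLaw f σ State.L) (measurable_actions m)
  have iv := integrable_stagePayoff hc i State.L (drawLaw f σ State.L)
    ((measurable_actions m).comp (measurable_deviateDraw (T := T) (a := a) (D := D) i))
  have key := integral_mono_ae (iA.neg.sub iB) (iv.sub iu)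
    ((ae_drawLaw_coolOffPure (f := f) hσ.1 State.L).mono fun z hz => stage_diff_L hc hz hinv m)
  rw [integral_sub' iA.neg iB, integral_sub' iv iu, integral_neg'] at key
  have eA : ∫ z, (if n ≤ m then (missEventOn i a D).indicator (1 : Draw X → ℝ) z
      else 0) ∂(drawLaw f σ State.L) =
      if n ≤ m then (drawLaw f σ State.L).real (missEventOn i a D) else 0 := by
    split_ifs
    · exact integral_indicator_one (measurableSet_missEventOn i a D)
    · simp
  have eB : ∫ z, (if n + T (n + 1) + 1 ≤ m then (missEvent i a).indicator (1 : Draw X → ℝ) z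
      else 0) ∂(drawLaw f σ State.L) =
      if n + T (n + 1) + 1 ≤ m then (drawLaw f σ State.L).real (missEvent i a) else 0 := by
    split_ifs
    · exact integral_indicator_one (measurableSet_missEvent i a)
    · simp
  rw [eA, eB] at key
  rw [integral_actions_update]
  have h0 : (0 : ℝ) ≤ (1 - δ) * δ ^ m := mul_nonneg (by linarith [hδ.2]) (pow_nonneg hδ.1.le m)
  have := mul_le_mul_of_nonneg_left key h0
  simp only [Function.comp_apply] at this
  linarith

open Classical in
-- Of the deviation's gain only the one at time `n` is kept, with weight `(1 - δ) * δ ^ n`; the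
-- later ones are nonnegative. Against it stands the largest possible value of the original plan
-- after the cool-off phase.
theorem statePayoff_update_H {f : State → PMF X} (hfull : ∀ θ x, f θ x ≠ 0)
    {σ : Fin 2 → MixedStrategy X} {c δ ε : ℝ}
    (hc : c ∈ Set.Ioo (0 : ℝ) 1) (hδ : δ ∈ Set.Ioo (0 : ℝ) 1) (hij : i ≠ j) (hcε : 0 ≤ 1 - ε - c)
    (hσ : ∀ k, σ k ∈ coolOffStrategies f T ε k) (hinv : IsInvestment T a)
    (hbr : ¬ CoolOffBreach T a) :
    (1 - δ) * δ ^ n * ((1 - ε - c) * (drawLaw f σ State.H).real (missEventOn i a D)) -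
        δ ^ (n + T (n + 1) + 1) * (drawLaw f σ State.H).real (missEvent i a) ≤
      statePayoff f c δ (Function.update σ i (deviateMixed T a D (σ i))) i State.H -
        statePayoff f c δ σ i State.H := by
  have h1 := hasSum_statePayoff hc hδ f (Function.update σ i (deviateMixed T a D (σ i))) i State.H
  have h2 := hasSum_statePayoff hc hδ f σ i State.H
  have b1 := hasSum_discounted_single δ n
    ((1 - ε - c) * (drawLaw f σ State.H).real (missEventOn i a D))
  have b2 := hasSum_discounted_tail hδ (n + T (n + 1) + 1)
    ((drawLaw f σ State.H).real (missEvent i a))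
  refine hasSum_le (fun m => ?_) (b1.sub b2) (h1.sub h2)
  have iu := integrable_stagePayoff hc i State.H (drawLaw f σ State.H) (measurable_actions m)
  have iv := integrable_stagePayoff hc i State.H (drawLaw f σ State.H)
    ((measurable_actions m).comp (measurable_deviateDraw (T := T) (a := a) (D := D) i))
  have iA : Integrable (fun z => if n ≤ m then (missEvent i a).indicator
      (fun z => stagePayoff c i (actions m (deviateDraw T a D i z)) State.H) z else 0)
      (drawLaw f σ State.H) := by
    split_ifs
    · exact iv.indicator (measurableSet_missEvent i a)
    · exact integrable_zero _ _ _
  have iB : Integrable (fun z => if n + T (n + 1) + 1 ≤ m then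
      (missEvent i a).indicator (1 : Draw X → ℝ) z else 0) (drawLaw f σ State.H) := by
    split_ifs
    · exact (integrable_const (1 : ℝ)).indicator (measurableSet_missEvent i a)
    · exact integrable_zero _ _ _
  have key := integral_mono_ae (iA.sub iB) (iv.sub iu)
    ((ae_drawLaw_coolOffPure (f := f) (hσ i).1 State.H).mono fun z hz => stage_diff_H hc hz hinv m)
  rw [integral_sub' iA iB, integral_sub' iv iu] at key
  have eA : (if m = n then (1 - ε - c) * (drawLaw f σ State.H).real (missEventOn i a D) else 0) ≤
      ∫ z, (if n ≤ m then (missEvent i a).indicator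
      (fun z => stagePayoff c i (actions m (deviateDraw T a D i z)) State.H) z else 0)
      ∂(drawLaw f σ State.H) := by
    by_cases hm : n ≤ m
    · simp only [if_pos hm]
      exact integral_stage_missEvent_ge hfull hij hcε hσ hinv hbr hm
    · simp only [if_neg hm]
      rw [if_neg (by omega)]
      simp
  have eB : ∫ z, (if n + T (n + 1) + 1 ≤ m then (missEvent i a).indicator (1 : Draw X → ℝ) z
      else 0) ∂(drawLaw f σ State.H) =
      if n + T (n + 1) + 1 ≤ m then (drawLaw f σ State.H).real (missEvent i a) else 0 := by
    split_ifs
    · exact integral_indicator_one (measurableSet_missEvent i a)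
    · simp
  rw [eB] at key
  rw [integral_actions_update]
  have h0 : (0 : ℝ) ≤ (1 - δ) * δ ^ m := mul_nonneg (by linarith [hδ.2]) (pow_nonneg hδ.1.le m)
  have h3 := mul_le_mul_of_nonneg_left key h0
  have h4 := mul_le_mul_of_nonneg_left eA h0
  simp only [Function.comp_apply] at h3
  linarith

/-- In a restricted equilibrium, missing an investment at `a` with signals in `D` is not improved
upon by investing. -/
theorem equilibrium_missEventOn_le {p₀ : ℝ} (hp₀ : p₀ ∈ Set.Ioo (0 : ℝ) 1) {f : State → PMF X}
    (hfull : ∀ θ x, f θ x ≠ 0) {σ : Fin 2 → MixedStrategy X} {c δ ε : ℝ}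
    (hc : c ∈ Set.Ioo (0 : ℝ) 1) (hδ : δ ∈ Set.Ioo (0 : ℝ) 1) (hε : 0 < ε) (hij : i ≠ j)
    (hcε : 0 ≤ 1 - ε - c) (hσ : IsRestrictedEquilibrium p₀ f c δ T ε σ) (hinv : IsInvestment T a)
    (hbr : ¬ CoolOffBreach T a) (D : Set (Fin (n + 1) → X)) :
    (1 - δ) * (1 - ε - c) * (p₀ * (drawLaw f σ State.H).real (missEventOn i a D)) ≤
      (1 - p₀) * (drawLaw f σ State.L).real (missEventOn i a D) +
      δ ^ (T (n + 1)) * (p₀ * (drawLaw f σ State.H).real (missEvent i a) +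
        (1 - p₀) * (drawLaw f σ State.L).real (missEvent i a)) := by
  have h := hσ.2 i (deviateMixed T a D (σ i)) (deviateMixed_mem hfull hε (hσ.1 i))
  rw [expectedPayoff_eq hp₀ hc hδ, expectedPayoff_eq hp₀ hc hδ] at h
  have hH := statePayoff_update_H (D := D) hfull hc hδ hij hcε hσ.1 hinv hbr
  have hL := statePayoff_update_L (D := D) (f := f) hc hδ (hσ.1 i) hinv
  have hH' := mul_le_mul_of_nonneg_left hH hp₀.1.le
  have hL' := mul_le_mul_of_nonneg_left hL (show 0 ≤ 1 - p₀ by linarith [hp₀.2])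
  have hn : 0 < δ ^ n := pow_pos hδ.1 n
  -- One surplus factor `δ` is discarded so that `δ ^ n` cancels from all terms.
  have hT : δ ^ (n + T (n + 1) + 1) ≤ δ ^ n * δ ^ T (n + 1) := by
    rw [← pow_add]
    exact pow_le_pow_of_le_one hδ.1.le hδ.2.le (by omega)
  set P := p₀ * (drawLaw f σ State.H).real (missEvent i a) +
        (1 - p₀) * (drawLaw f σ State.L).real (missEvent i a) with hP
  have hP0 : 0 ≤ P := add_nonneg (mul_nonneg hp₀.1.le measureReal_nonneg)
    (mul_nonneg (by linarith [hp₀.2]) measureReal_nonneg)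
  have hTP := mul_le_mul_of_nonneg_right hT hP0
  refine le_of_mul_le_mul_left ?_ hn
  rw [hP] at hTP ⊢
  linarith

end Payoff

/-! ### Hellinger coefficient and likelihood-ratio bounds -/

section Hellinger

variable {X : Type*} [Fintype X]

theorem hell_nonneg (f : State → PMF X) (x : X) : 0 ≤ hell f x := Real.sqrt_nonneg _

/-- The sum of the squares `(√f_H - √f_L) ^ 2` equals `2 - 2 ∑ √(f_H f_L)` and is positive because
the laws differ. -/
theorem sum_hell_lt_one {f : State → PMF X} (hinf : f State.H ≠ f State.L) :
    ∑ x, hell f x < 1 := by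
  obtain ⟨x₀, hx₀⟩ : ∃ x, f State.H x ≠ f State.L x := by
    by_contra! h
    exact hinf (PMF.ext h)
  have hne : dens f State.H x₀ ≠ dens f State.L x₀ := fun h => hx₀
    ((ENNReal.toReal_eq_toReal_iff' (PMF.apply_ne_top _ _) (PMF.apply_ne_top _ _)).1 h)
  have hsq : ∀ x, (√(dens f State.H x) - √(dens f State.L x)) ^ 2 =
      dens f State.H x + dens f State.L x - 2 * hell f x := by
    intro x
    rw [hell, Real.sqrt_mul (dens_nonneg f _ _), sub_sq, Real.sq_sqrt (dens_nonneg f _ _),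
      Real.sq_sqrt (dens_nonneg f _ _)]
    ring
  have hpos : 0 < ∑ x, (√(dens f State.H x) - √(dens f State.L x)) ^ 2 := by
    refine Finset.sum_pos' (fun x _ => sq_nonneg _) ⟨x₀, Finset.mem_univ _, ?_⟩
    refine sq_pos_iff.2 (sub_ne_zero.2 fun h => hne ?_)
    exact (Real.sqrt_inj (dens_nonneg f _ _) (dens_nonneg f _ _)).1 h
  simp_rw [hsq] at hpos
  rw [Finset.sum_sub_distrib, Finset.sum_add_distrib, sum_dens, sum_dens, ← Finset.mul_sum] at hpos
  linarith

/-- A bound on the likelihood ratio of the low to the high state. -/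
def ratioBound (f : State → PMF X) : ℝ := ∑ x, dens f State.L x / dens f State.H x

theorem ratioBound_nonneg (f : State → PMF X) : 0 ≤ ratioBound f :=
  Finset.sum_nonneg fun _ _ => div_nonneg (dens_nonneg f _ _) (dens_nonneg f _ _)

theorem dens_L_le {f : State → PMF X} (hfull : ∀ θ x, f θ x ≠ 0) (x : X) :
    dens f State.L x ≤ ratioBound f * dens f State.H x := by
  rw [← div_le_iff₀ (dens_pos hfull State.H x)]
  exact Finset.single_le_sum (f := fun x => dens f State.L x / dens f State.H x)
    (fun _ _ => div_nonneg (dens_nonneg f _ _) (dens_nonneg f _ _)) (Finset.mem_univ x)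

theorem hell_le {f : State → PMF X} (hfull : ∀ θ x, f θ x ≠ 0) (x : X) :
    hell f x ≤ √(ratioBound f) * dens f State.H x := by
  have h0 := dens_nonneg f State.H x
  refine Real.sqrt_le_iff.2 ⟨mul_nonneg (Real.sqrt_nonneg _) h0, ?_⟩
  rw [mul_pow, Real.sq_sqrt (ratioBound_nonneg f)]
  nlinarith [dens_L_le hfull x]

end Hellinger

/-! ### Evolution of doubt along a history -/

section Doubt

variable {X : Type*} [MeasurableSpace X] [Fintype X] [DiscreteMeasurableSpace X]
  {p₀ : ℝ} {f : State → PMF X} {σ : Fin 2 → MixedStrategy X} {i j : Fin 2} {T : ℕ → ℕ} {n : ℕ}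

theorem reach_succ (w : X → ℝ) (a : ActionHistory (n + 1)) :
    reach w σ i a = (∑ x, w x) *
      mass w (σ i : Measure (PureStrategy X)) (choiceSet i (Fin.init a) (a (Fin.last n) i)) :=
  mass_consistent_succ i a

theorem mass_choiceSet_le {w : X → ℝ} (hw : ∀ x, 0 ≤ w x) (a : ActionHistory n) (b : Act) :
    mass w (σ i : Measure (PureStrategy X)) (choiceSet i a b) ≤ reach w σ i a :=
  mass_mono hw fun x => choiceSet_subset i a b x

theorem reach_succ_le {w : X → ℝ} (hw : ∀ x, 0 ≤ w x) (a : ActionHistory (n + 1)) :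
    reach w σ i a ≤ (∑ x, w x) * reach w σ i (Fin.init a) := by
  rw [reach_succ]
  exact mul_le_mul_of_nonneg_left (mass_choiceSet_le hw _ _) (Finset.sum_nonneg fun x _ => hw x)

theorem reach_init_pos {a : ActionHistory (n + 1)} (h : 0 < reach (dens f State.H) σ i a) :
    0 < reach (dens f State.H) σ i (Fin.init a) := by
  have := reach_succ_le (σ := σ) (i := i) (dens_nonneg f State.H) a
  rw [sum_dens, one_mul] at this
  linarith

theorem exists_consistent_of_reach_pos {w : X → ℝ} {a : ActionHistory n}
    (h : 0 < reach w σ i a) (hS : (σ i : Measure (PureStrategy X)).support ⊆ coolOffPure X T) :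
    ∃ x, ∃ s ∈ coolOffPure X T, Consistent i s a x := by
  obtain ⟨x, -, hx⟩ := Finset.exists_ne_zero_of_sum_ne_zero h.ne'
  refine ⟨x, ?_⟩
  by_contra! hno
  have : (σ i : Measure (PureStrategy X)) (consistentSet i a x) = 0 :=
    measure_mono_null (fun s hs hS => hno s hS hs) (ae_iff.1 (ae_mem_coolOffPure hS))
  simp [measureReal_def, this] at hx

theorem not_coolOffBreach_of_reach_pos {w : X → ℝ} {a : ActionHistory n}
    (h : ∀ k, 0 < reach w σ k a)
    (hS : ∀ k, (σ k : Measure (PureStrategy X)).support ⊆ coolOffPure X T) :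
    ¬ CoolOffBreach T a := by
  rintro ⟨k, hk, l, hl⟩
  obtain ⟨x, s, hs, hcon⟩ := exists_consistent_of_reach_pos (h l) (hS l)
  have h1 := hcon k
  rw [hs.1 _ _ _ hk, hl] at h1
  cases h1

/-- In a cool-off phase almost every drawn strategy plays `N`, so the recorded action discards no
weight and only the factor of the new signal remains. Reachability under `w` gives the identity for
every other weight `v`. -/
theorem reach_succ_of_coolOff {w v : X → ℝ} {a : ActionHistory (n + 1)}
    (h : 0 < reach w σ i a) (hS : (σ i : Measure (PureStrategy X)).support ⊆ coolOffPure X T)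
    (hc : IsCoolOff T (Fin.init a)) :
    reach v σ i a = (∑ x, v x) * reach v σ i (Fin.init a) := by
  obtain ⟨x, s, hs, hcon⟩ := exists_consistent_of_reach_pos h hS
  have hN : a (Fin.last n) i = Act.N := by
    rw [← ((consistent_succ_iff i s a x).1 hcon).2]
    exact hs.1 _ _ _ hc
  rw [reach_succ, hN]
  congr 1
  refine Finset.sum_congr rfl fun y _ => ?_
  congr 1
  refine measureReal_congr ?_
  filter_upwards [ae_mem_coolOffPure hS] with s hs
  exact propext ⟨fun h => h.1, fun h => ⟨h, hs.1 _ _ _ hc⟩⟩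

theorem Doubt.mono {a : ActionHistory n} {η η' : ℝ} (h : Doubt p₀ f σ i j a η) (hη : η ≤ η') :
    Doubt p₀ f σ i j a η' :=
  h.trans (mul_le_mul_of_nonneg_right hη
    (mul_nonneg (mass_nonneg (dens_nonneg f _) _) (Real.sqrt_nonneg _)))

/-- The weights under `H` and `L` are unchanged, since signal probabilities sum to one. Only player
`i`'s Hellinger weight picks up the factor `∑ x, hell f x`. -/
theorem Doubt.coolOff {a : ActionHistory (n + 1)} {η : ℝ}
    (h : Doubt p₀ f σ i j (Fin.init a) η) (hpos : ∀ k, 0 < reach (dens f State.H) σ k a)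
    (hS : ∀ k, (σ k : Measure (PureStrategy X)).support ⊆ coolOffPure X T)
    (hc : IsCoolOff T (Fin.init a)) : Doubt p₀ f σ i j a (η * ∑ x, hell f x) := by
  unfold Doubt at *
  rw [reach_succ_of_coolOff (hpos i) (hS i) hc, reach_succ_of_coolOff (hpos i) (hS i) hc,
    reach_succ_of_coolOff (hpos j) (hS j) hc, reach_succ_of_coolOff (hpos j) (hS j) hc,
    sum_dens, sum_dens, one_mul, one_mul, one_mul]
  have h0 : 0 ≤ ∑ x, hell f x := Finset.sum_nonneg fun x _ => hell_nonneg f x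
  have := mul_le_mul_of_nonneg_left h h0
  linarith

/-- A bound on the doubt after an arbitrary history of length `n`. -/
def crudeDoubt (p₀ : ℝ) (f : State → PMF X) (n : ℕ) : ℝ :=
  √(ratioBound f) ^ (n + 1) * √((1 - p₀) / p₀ * ratioBound f ^ (n + 1))

theorem crudeDoubt_nonneg (p₀ : ℝ) (f : State → PMF X) (n : ℕ) : 0 ≤ crudeDoubt p₀ f n :=
  mul_nonneg (pow_nonneg (Real.sqrt_nonneg _) _) (Real.sqrt_nonneg _)

/-- Each of the `n + 1` signals changes the weights by a bounded ratio, and the strategy measures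
are the same in both states. The bound is therefore uniform over strategies, which allows `T` to be
fixed before the equilibrium is known. -/
theorem doubt_crudeDoubt (hp₀ : p₀ ∈ Set.Ioo (0 : ℝ) 1) (hfull : ∀ θ x, f θ x ≠ 0)
    (a : ActionHistory n) : Doubt p₀ f σ i j a (crudeDoubt p₀ f n) := by
  have h1 : reach (hell f) σ i a ≤ √(ratioBound f) ^ (n + 1) * reach (dens f State.H) σ i a :=
    mass_le_mul (hell_nonneg f) (hell_le hfull) _
  have h2 : reach (dens f State.L) σ j a ≤ ratioBound f ^ (n + 1) * reach (dens f State.H) σ j a :=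
    mass_le_mul (dens_nonneg f _) (dens_L_le hfull) _
  have hp : 0 ≤ 1 - p₀ := by linarith [hp₀.2]
  have h3 : √((1 - p₀) * reach (dens f State.L) σ j a) ≤
      √((1 - p₀) / p₀ * ratioBound f ^ (n + 1)) * √(p₀ * reach (dens f State.H) σ j a) := by
    rw [← Real.sqrt_mul (mul_nonneg (div_nonneg hp hp₀.1.le)
      (pow_nonneg (ratioBound_nonneg f) _))]
    refine Real.sqrt_le_sqrt ?_
    have hp' : p₀ ≠ 0 := hp₀.1.ne'
    calc (1 - p₀) * reach (dens f State.L) σ j a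
        ≤ (1 - p₀) * (ratioBound f ^ (n + 1) * reach (dens f State.H) σ j a) :=
          mul_le_mul_of_nonneg_left h2 hp
      _ = _ := by field_simp
  refine (mul_le_mul h1 h3 (Real.sqrt_nonneg _) (mul_nonneg (pow_nonneg (Real.sqrt_nonneg _) _)
    (mass_nonneg (dens_nonneg f _) _))).trans (le_of_eq ?_)
  unfold crudeDoubt
  ring

/-- On the left the new signal contributes `∑ x, hell f x ≤ (1 - κ) ^ 2`, while conditioning on
investment only lowers the other weights there. On the right each player's `H`-weight falls by at
most the factor `1 - κ`. The two effects cancel. -/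
theorem Doubt.invest (hp₀ : p₀ ∈ Set.Ioo (0 : ℝ) 1) {a : ActionHistory (n + 1)} {η κ : ℝ}
    (hη : 0 ≤ η)
    (h : Doubt p₀ f σ i j (Fin.init a) η) (hκ0 : 0 ≤ κ) (hκ1 : κ ≤ 1)
    (hκ : ∑ x, hell f x ≤ (1 - κ) ^ 2) (ha : a (Fin.last n) = bothInvest)
    (hI : ∀ k, (1 - κ) * reach (dens f State.H) σ k (Fin.init a) ≤
      mass (dens f State.H) (σ k : Measure (PureStrategy X)) (choiceSet k (Fin.init a) Act.I)) :
    Doubt p₀ f σ i j a η := by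
  have hI' : ∀ k, (1 - κ) * reach (dens f State.H) σ k (Fin.init a) ≤
      reach (dens f State.H) σ k a := by
    intro k
    rw [reach_succ, sum_dens, one_mul, ha]
    exact hI k
  have hL : reach (dens f State.L) σ j a ≤ reach (dens f State.L) σ j (Fin.init a) := by
    have := reach_succ_le (σ := σ) (i := j) (dens_nonneg f State.L) a
    rwa [sum_dens, one_mul] at this
  have hB := reach_succ_le (σ := σ) (i := i) (hell_nonneg f) a
  have hp : 0 ≤ 1 - p₀ := by linarith [hp₀.2]
  have hk : 0 ≤ 1 - κ := by linarith
  have h0 : ∀ (θ : State) (k : Fin 2), 0 ≤ reach (dens f θ) σ k (Fin.init a) := fun θ k =>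
    mass_nonneg (dens_nonneg f _) _
  have h0' : 0 ≤ reach (hell f) σ i (Fin.init a) := mass_nonneg (hell_nonneg f) _
  unfold Doubt at *
  -- The opponent's weight sits under a root, so it loses only `√(1 - κ)`; the cruder `1 - κ` is
  -- enough.
  have hs : (1 - κ) * √(p₀ * reach (dens f State.H) σ j (Fin.init a)) ≤
      √(p₀ * reach (dens f State.H) σ j a) := by
    refine Real.le_sqrt_of_sq_le ?_
    rw [mul_pow, Real.sq_sqrt (mul_nonneg hp₀.1.le (h0 _ _))]
    have h1 := mul_le_mul_of_nonneg_left (hI' j) hp₀.1.le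
    have h2 : (1 - κ) ^ 2 ≤ 1 - κ := by nlinarith
    have h3 := mul_le_mul_of_nonneg_right h2 (mul_nonneg hp₀.1.le (h0 State.H j))
    linarith
  calc reach (hell f) σ i a * √((1 - p₀) * reach (dens f State.L) σ j a)
      ≤ ((1 - κ) ^ 2 * reach (hell f) σ i (Fin.init a)) *
        √((1 - p₀) * reach (dens f State.L) σ j (Fin.init a)) :=
        mul_le_mul (hB.trans (mul_le_mul_of_nonneg_right hκ h0'))
          (Real.sqrt_le_sqrt (mul_le_mul_of_nonneg_left hL hp)) (Real.sqrt_nonneg _) (by positivity)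
    _ = (1 - κ) ^ 2 * (reach (hell f) σ i (Fin.init a) *
        √((1 - p₀) * reach (dens f State.L) σ j (Fin.init a))) := by ring
    _ ≤ (1 - κ) ^ 2 * (η * (reach (dens f State.H) σ i (Fin.init a) *
        √(p₀ * reach (dens f State.H) σ j (Fin.init a)))) :=
        mul_le_mul_of_nonneg_left h (sq_nonneg _)
    _ = η * (((1 - κ) * reach (dens f State.H) σ i (Fin.init a)) *
        ((1 - κ) * √(p₀ * reach (dens f State.H) σ j (Fin.init a)))) := by ring
    _ ≤ _ := mul_le_mul_of_nonneg_left (mul_le_mul (hI' i) hs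
        (mul_nonneg hk (Real.sqrt_nonneg _)) (mass_nonneg (dens_nonneg f _) _)) hη

/-- The signals after which player `i`'s likelihood ratio of the low state is at most `z`. -/
def confident (p₀ : ℝ) (f : State → PMF X) (σ : Fin 2 → MixedStrategy X) (j : Fin 2)
    (a : ActionHistory n) (z : ℝ) : Set (Fin (n + 1) → X) :=
  {x | (1 - p₀) * (∏ k, dens f State.L (x k)) * reach (dens f State.L) σ j a ≤
    z * (p₀ * (∏ k, dens f State.H (x k)) * reach (dens f State.H) σ j a)}

/-- A Markov-type inequality: at an unconfident signal the joint weights satisfy `l > z h`, so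
`√(hl) ≥ √z · h`, and the affinity bounds the `H`-mass of such signals. -/
theorem mass_unconfident_le (hp₀ : p₀ ∈ Set.Ioo (0 : ℝ) 1) {a : ActionHistory n} {η z : ℝ}
    (hz : 0 ≤ z) (hpos : 0 < reach (dens f State.H) σ j a) (h : Doubt p₀ f σ i j a η) :
    √z * mass (dens f State.H) (σ i : Measure (PureStrategy X))
      (fun x => {s | s ∈ consistentSet i a x ∧ x ∉ confident p₀ f σ j a z}) ≤
      η * reach (dens f State.H) σ i a := by
  have hr : 0 < √(p₀ * reach (dens f State.H) σ j a) := Real.sqrt_pos.2 (mul_pos hp₀.1 hpos)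
  refine le_of_mul_le_mul_right ?_ hr
  have h' : mass (dens f State.H) (σ i : Measure (PureStrategy X))
      (fun x => {s | s ∈ consistentSet i a x ∧ x ∉ confident p₀ f σ j a z}) *
      (√z * √(p₀ * reach (dens f State.H) σ j a)) ≤
      reach (hell f) σ i a * √((1 - p₀) * reach (dens f State.L) σ j a) := by
    have eU : mass (dens f State.H) (σ i : Measure (PureStrategy X))
        (fun x => {s | s ∈ consistentSet i a x ∧ x ∉ confident p₀ f σ j a z}) =
        ∑ x, (∏ k, dens f State.H (x k)) * (σ i : Measure (PureStrategy X)).real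
          {s | s ∈ consistentSet i a x ∧ x ∉ confident p₀ f σ j a z} := rfl
    have eB : reach (hell f) σ i a = ∑ x, (∏ k, hell f (x k)) *
        (σ i : Measure (PureStrategy X)).real (consistentSet i a x) := rfl
    rw [eU, eB, Finset.sum_mul, Finset.sum_mul]
    refine Finset.sum_le_sum fun x _ => ?_
    have gH : 0 ≤ ∏ k, dens f State.H (x k) := Finset.prod_nonneg fun k _ => dens_nonneg f _ _
    have gL : 0 ≤ ∏ k, dens f State.L (x k) := Finset.prod_nonneg fun k _ => dens_nonneg f _ _
    by_cases hx : x ∈ confident p₀ f σ j a z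
    · have : {s : PureStrategy X | s ∈ consistentSet i a x ∧ x ∉ confident p₀ f σ j a z} = ∅ := by
        ext s; simp [hx]
      rw [this, measureReal_empty, mul_zero, zero_mul]
      exact mul_nonneg (mul_nonneg (Finset.prod_nonneg fun k _ => hell_nonneg f _)
        measureReal_nonneg) (Real.sqrt_nonneg _)
    · have : {s : PureStrategy X | s ∈ consistentSet i a x ∧ x ∉ confident p₀ f σ j a z} =
          consistentSet i a x := by
        ext s; simp [hx]
      rw [this]
      have hx' : z * (p₀ * (∏ k, dens f State.H (x k)) * reach (dens f State.H) σ j a) ≤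
          (1 - p₀) * (∏ k, dens f State.L (x k)) * reach (dens f State.L) σ j a :=
        (not_le.1 hx).le
      have e2 : ∏ k, hell f (x k) =
          √((∏ k, dens f State.H (x k)) * (∏ k, dens f State.L (x k))) := by
        rw [← Finset.prod_mul_distrib]
        exact (Real.sqrt_prod _ fun k _ => mul_nonneg (dens_nonneg f _ _) (dens_nonneg f _ _)).symm
      have key : (∏ k, dens f State.H (x k)) * (√z * √(p₀ * reach (dens f State.H) σ j a)) ≤
          (∏ k, hell f (x k)) * √((1 - p₀) * reach (dens f State.L) σ j a) := by
        rw [e2, ← Real.sqrt_mul (mul_nonneg gH gL), ← Real.sqrt_mul hz]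
        refine Real.le_sqrt_of_sq_le ?_
        rw [mul_pow, Real.sq_sqrt (mul_nonneg hz (mul_nonneg hp₀.1.le hpos.le))]
        have := mul_le_mul_of_nonneg_left hx' gH
        linarith
      have := mul_le_mul_of_nonneg_right key
        (measureReal_nonneg (μ := (σ i : Measure (PureStrategy X))) (s := consistentSet i a x))
      linarith
  refine (le_of_eq ?_).trans (h'.trans (h.trans (le_of_eq ?_))) <;> ring

theorem mass_confident_le {a : ActionHistory n} {z : ℝ}
    {Q : (Fin (n + 1) → X) → Set (PureStrategy X)}
    (hQ : ∀ x, x ∉ confident p₀ f σ j a z → Q x = ∅) :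
    (1 - p₀) * (mass (dens f State.L) (σ i : Measure (PureStrategy X)) Q *
      reach (dens f State.L) σ j a) ≤
    z * (p₀ * (mass (dens f State.H) (σ i : Measure (PureStrategy X)) Q *
      reach (dens f State.H) σ j a)) := by
  conv_lhs => rw [mass, Finset.sum_mul, Finset.mul_sum]
  conv_rhs => rw [mass, Finset.sum_mul, Finset.mul_sum, Finset.mul_sum]
  refine Finset.sum_le_sum fun x _ => ?_
  by_cases hx : x ∈ confident p₀ f σ j a z
  · have := mul_le_mul_of_nonneg_right hx
      (measureReal_nonneg (μ := (σ i : Measure (PureStrategy X))) (s := Q x))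
    linarith
  · simp [hQ x hx]

/-- Failures to invest are split by confidence. Unconfident signals have `H`-mass at most the
fraction `κ / 2` because doubt is small; failures at confident signals are limited to another `κ /
2` by the equilibrium inequality, because the cool-off phase leaves only a small continuation value.
-/
theorem investProb_ge (hp₀ : p₀ ∈ Set.Ioo (0 : ℝ) 1)
    (hfull : ∀ θ x, f θ x ≠ 0) {c δ ε : ℝ}
    (hc : c ∈ Set.Ioo (0 : ℝ) 1) (hδ : δ ∈ Set.Ioo (0 : ℝ) 1) (hε : 0 < ε) (hij : i ≠ j)
    (hcε : 0 < 1 - ε - c) (hσ : IsRestrictedEquilibrium p₀ f c δ T ε σ) {a : ActionHistory n}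
    (hinv : IsInvestment T a) (hpos : ∀ k, 0 < reach (dens f State.H) σ k a) {η κ : ℝ}
    (hdoubt : Doubt p₀ f σ i j a η)
    (hη : η ≤ √((1 - δ) * (1 - ε - c) / 2) * (κ / 2))
    (hT : δ ^ T (n + 1) * (p₀ + (1 - p₀) * (ratioBound f ^ (n + 1) * ratioBound f ^ (n + 1))) ≤
      (1 - δ) * (1 - ε - c) / 2 * p₀ * (κ / 2)) :
    (1 - κ) * reach (dens f State.H) σ i a ≤
      mass (dens f State.H) (σ i : Measure (PureStrategy X)) (choiceSet i a Act.I) := by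
  have hp : 0 ≤ 1 - p₀ := by linarith [hp₀.2]
  have hbr := not_coolOffBreach_of_reach_pos hpos fun k => (hσ.1 k).1
  set z := (1 - δ) * (1 - ε - c) / 2 with hz
  have hz0 : 0 < z := by
    have : 0 < 1 - δ := by linarith [hδ.2]
    positivity
  set D := confident p₀ f σ j a z with hD
  set N : State → ℝ := fun θ => mass (dens f θ) (σ i : Measure (PureStrategy X))
    (fun x => consistentSet i a x ∩ {s | x ∈ D ∧ s ⟨n, a, x⟩ = Act.N}) with hN
  have heq := equilibrium_missEventOn_le hp₀ hfull hc hδ hε hij hcε.le hσ hinv hbr D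
  have hconf : (1 - p₀) * (N State.L * reach (dens f State.L) σ j a) ≤
      z * (p₀ * (N State.H * reach (dens f State.H) σ j a)) :=
    mass_confident_le fun x hx => by
      ext s
      simp only [Set.mem_inter_iff, Set.mem_ofPred_eq, Set.mem_empty_iff_false, iff_false]
      exact fun h => hx h.2.1
  rw [drawLaw_missEventOn f σ State.H hij, drawLaw_missEventOn f σ State.L hij] at heq
  have hmiss : ∀ θ, (drawLaw f σ θ).real (missEvent i a) ≤
      reach (dens f θ) σ i a * reach (dens f θ) σ j a := by
    intro θ
    rw [← missEventOn_univ, drawLaw_missEventOn f σ θ hij]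
    exact mul_le_mul_of_nonneg_right
      (mass_mono (dens_nonneg f θ) fun x => Set.inter_subset_left) (mass_nonneg (dens_nonneg f θ) _)
  have hLk : ∀ k, reach (dens f State.L) σ k a ≤
      ratioBound f ^ (n + 1) * reach (dens f State.H) σ k a := fun k =>
    mass_le_mul (dens_nonneg f _) (dens_L_le hfull) _
  have hLL : reach (dens f State.L) σ i a * reach (dens f State.L) σ j a ≤
      ratioBound f ^ (n + 1) * ratioBound f ^ (n + 1) *
        (reach (dens f State.H) σ i a * reach (dens f State.H) σ j a) := by
    refine (mul_le_mul (hLk i) (hLk j) (mass_nonneg (dens_nonneg f _) _)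
      (mul_nonneg (pow_nonneg (ratioBound_nonneg f) _) (hpos i).le)).trans (le_of_eq ?_)
    ring
  have hP : p₀ * (drawLaw f σ State.H).real (missEvent i a) +
      (1 - p₀) * (drawLaw f σ State.L).real (missEvent i a) ≤
      (p₀ + (1 - p₀) * (ratioBound f ^ (n + 1) * ratioBound f ^ (n + 1))) *
        (reach (dens f State.H) σ i a * reach (dens f State.H) σ j a) := by
    have h1 := mul_le_mul_of_nonneg_left (hmiss State.H) hp₀.1.le
    have h2 := mul_le_mul_of_nonneg_left ((hmiss State.L).trans hLL) hp
    linarith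
  have hP' := mul_le_mul_of_nonneg_left hP (pow_nonneg hδ.1.le (T (n + 1)))
  have hT' := mul_le_mul_of_nonneg_right hT (mul_pos (hpos i) (hpos j)).le
  -- The gain coefficient is `2 * z`. Confidence bounds the low-state loss by `z` times the same
  -- quantity, and the remaining `z` must be covered by the discounted continuation.
  have hNH : N State.H ≤ κ / 2 * reach (dens f State.H) σ i a := by
    have hfac : 0 < z * p₀ * reach (dens f State.H) σ j a :=
      mul_pos (mul_pos hz0 hp₀.1) (hpos j)
    refine le_of_mul_le_mul_left ?_ hfac
    have hz2 : (1 - δ) * (1 - ε - c) = 2 * z := by rw [hz]; ring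
    rw [hz2] at heq
    change 2 * z * (p₀ * (N State.H * reach (dens f State.H) σ j a)) ≤
      (1 - p₀) * (N State.L * reach (dens f State.L) σ j a) + _ at heq
    linarith
  have hlow := mass_unconfident_le hp₀ hz0.le (hpos j) hdoubt
  set U := mass (dens f State.H) (σ i : Measure (PureStrategy X))
      (fun x => {s | s ∈ consistentSet i a x ∧ x ∉ confident p₀ f σ j a z}) with hU
  have hU' : U ≤ κ / 2 * reach (dens f State.H) σ i a := by
    refine le_of_mul_le_mul_left ?_ (Real.sqrt_pos.2 hz0)
    refine hlow.trans ((mul_le_mul_of_nonneg_right hη (hpos i).le).trans (le_of_eq ?_))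
    ring
  have hw := dens_nonneg f State.H
  have hsplit := mass_add_mass_diff (w := dens f State.H) (σ := (σ i : Measure (PureStrategy X)))
    (consistentSet i a) (fun x => {s | s ⟨n, a, x⟩ = Act.I}) fun x => measurableSet_eval _ _
  have hsplit' := mass_add_mass_diff (w := dens f State.H) (σ := (σ i : Measure (PureStrategy X)))
    (fun x => consistentSet i a x \ {s | s ⟨n, a, x⟩ = Act.I}) (fun x => {_s | x ∈ D})
    fun x => MeasurableSet.const _
  have h1 : mass (dens f State.H) (σ i : Measure (PureStrategy X))
      (fun x => (consistentSet i a x \ {s | s ⟨n, a, x⟩ = Act.I}) ∩ {_s | x ∈ D}) ≤ N State.H :=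
    mass_mono hw fun x s hs => ⟨hs.1.1, hs.2, Act.eq_N_of_ne_I hs.1.2⟩
  have h2 : mass (dens f State.H) (σ i : Measure (PureStrategy X))
      (fun x => (consistentSet i a x \ {s | s ⟨n, a, x⟩ = Act.I}) \ {_s | x ∈ D}) ≤ U :=
    mass_mono hw fun x s hs => ⟨hs.1.1, hs.2⟩
  have h3 : mass (dens f State.H) (σ i : Measure (PureStrategy X))
      (fun x => consistentSet i a x ∩ {s | s ⟨n, a, x⟩ = Act.I}) =
      mass (dens f State.H) (σ i : Measure (PureStrategy X)) (choiceSet i a Act.I) := rfl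
  unfold reach at *
  linarith

/-- Induction on the length, with one invariant per phase. In a cool-off phase doubt is the crude
bound at its start times one factor `β` per elapsed period; in an investment phase it is at most
`η`. A failed investment resets to the crude bound at length `m + 1`, so nothing about earlier play
is needed. -/
theorem doubt_le_of_reach_pos (hp₀ : p₀ ∈ Set.Ioo (0 : ℝ) 1)
    (hfull : ∀ θ x, f θ x ≠ 0) {c δ ε : ℝ}
    (hc : c ∈ Set.Ioo (0 : ℝ) 1) (hδ : δ ∈ Set.Ioo (0 : ℝ) 1) (hε : 0 < ε)
    (hcε : 0 < 1 - ε - c) (hσ : IsRestrictedEquilibrium p₀ f c δ T ε σ) {η κ : ℝ}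
    (hη0 : 0 ≤ η) (hκ0 : 0 ≤ κ) (hκ1 : κ ≤ 1) (hκ : ∑ x, hell f x ≤ (1 - κ) ^ 2)
    (hη : η ≤ √((1 - δ) * (1 - ε - c) / 2) * (κ / 2))
    (hT : ∀ n, δ ^ T (n + 1) *
      (p₀ + (1 - p₀) * (ratioBound f ^ (n + 1) * ratioBound f ^ (n + 1))) ≤
      (1 - δ) * (1 - ε - c) / 2 * p₀ * (κ / 2))
    (hTη : ∀ n, crudeDoubt p₀ f (n + 1) * (∑ x, hell f x) ^ T (n + 1) ≤ η)
    (hT0 : crudeDoubt p₀ f 0 * (∑ x, hell f x) ^ T 1 ≤ η) :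
    ∀ (n : ℕ) (a : ActionHistory n), (∀ k, 0 < reach (dens f State.H) σ k a) →
      (lastInvest T n a = none → ∀ i j, i ≠ j →
        Doubt p₀ f σ i j a (crudeDoubt p₀ f 0 * (∑ x, hell f x) ^ n)) ∧
      (∀ m, lastInvest T n a = some m → m < n → ∀ i j, i ≠ j →
        Doubt p₀ f σ i j a (crudeDoubt p₀ f (m + 1) * (∑ x, hell f x) ^ (n - (m + 1)))) ∧
      (lastInvest T n a = some n → ∀ i j, i ≠ j → Doubt p₀ f σ i j a η) := by
  set β := ∑ x, hell f x with hβ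
  have hβ0 : 0 ≤ β := Finset.sum_nonneg fun x _ => hell_nonneg f x
  have hβ1 : β ≤ 1 := hκ.trans (pow_le_one₀ (by linarith) (by linarith))
  have hS := fun k => (hσ.1 k).1
  intro n
  induction n with
  | zero =>
    intro a _
    refine ⟨fun _ i j _ => ?_, fun m _ hm => absurd hm (Nat.not_lt_zero m), fun h => ?_⟩
    · rw [pow_zero, mul_one]
      exact doubt_crudeDoubt hp₀ hfull a
    · simp [lastInvest] at h
  | succ n ih =>
    intro a hpos
    have hpos' : ∀ k, 0 < reach (dens f State.H) σ k (Fin.init a) := fun k =>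
      reach_init_pos (hpos k)
    obtain ⟨ih1, ih2, ih3⟩ := ih (Fin.init a) hpos'
    rw [lastInvest]
    rcases hl : lastInvest T n (Fin.init a) with _ | m
    · have hc : IsCoolOff T (Fin.init a) := by simp [IsCoolOff, IsInvestment, hl]
      have hd : ∀ i j, i ≠ j → Doubt p₀ f σ i j a (crudeDoubt p₀ f 0 * β ^ (n + 1)) := by
        intro i j hij
        have := (ih1 hl i j hij).coolOff hpos hS hc
        rwa [mul_assoc, ← pow_succ] at this
      simp only
      split_ifs with h
      · refine ⟨by simp, fun m hm hmn => ?_, fun _ i j hij => (hd i j hij).mono ?_⟩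
        · simp only [Option.some.injEq] at hm
          omega
        · refine le_trans (mul_le_mul_of_nonneg_left ?_ (crudeDoubt_nonneg _ _ _)) hT0
          exact pow_le_pow_of_le_one hβ0 hβ1 h.le
      · exact ⟨fun _ => hd, by simp, by simp⟩
    · simp only
      by_cases hmn : m = n
      · subst hmn
        rw [if_pos rfl]
        split_ifs with hb
        · refine ⟨by simp, fun k hk hkn => ?_, fun _ i j hij => ?_⟩
          · simp only [Option.some.injEq] at hk
            omega
          · refine (ih3 hl i j hij).invest hp₀ hη0 hκ0 hκ1 hκ hb fun k => ?_
            obtain ⟨l, hlk⟩ := exists_ne k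
            -- The doubt bound at the shorter history yields the investment probabilities that
            -- preserve it at the longer one.
            exact investProb_ge hp₀ hfull hc hδ hε hlk.symm hcε hσ hl hpos'
              (ih3 hl k l hlk.symm) hη (hT m)
        · refine ⟨by simp, fun k hk hkn i j hij => ?_, fun h => ?_⟩
          · simp only [Option.some.injEq] at hk
            subst hk
            rw [Nat.sub_self, pow_zero, mul_one]
            exact doubt_crudeDoubt hp₀ hfull a
          · simp at h
      · rw [if_neg hmn]
        have hmlt : m < n := lt_of_le_of_ne ((lastInvest_spec T n (Fin.init a)).1 m hl).1 hmn
        have hc : IsCoolOff T (Fin.init a) := by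
          simpa [IsCoolOff, IsInvestment, hl] using hmn
        have hd : ∀ i j, i ≠ j →
            Doubt p₀ f σ i j a (crudeDoubt p₀ f (m + 1) * β ^ (n + 1 - (m + 1))) := by
          intro i j hij
          have := (ih2 m hl hmlt i j hij).coolOff hpos hS hc
          rw [mul_assoc, ← pow_succ] at this
          rwa [show n + 1 - (m + 1) = n - (m + 1) + 1 by omega]
        split_ifs with h
        · refine ⟨by simp, fun k hk hkn => ?_, fun _ i j hij => (hd i j hij).mono ?_⟩
          · simp only [Option.some.injEq] at hk
            omega
          · refine le_trans (mul_le_mul_of_nonneg_left ?_ (crudeDoubt_nonneg _ _ _)) (hTη m)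
            -- Leaving the cool-off phase requires `m + T (m + 1) < n + 1`, so at least `T (m + 1)`
            -- contracting periods have passed since the failure.
            exact pow_le_pow_of_le_one hβ0 hβ1 (by omega)
        · refine ⟨by simp, fun k hk hkn i j hij => ?_, fun h => ?_⟩
          · simp only [Option.some.injEq] at hk
            subst hk
            exact hd i j hij
          · simp only [Option.some.injEq] at h
            omega

end Doubt

end CoolOff

end

/-! ### Choice of the constants and of the cool-off lengths -/

open CoolOff
theorem mainTheorem6 {X : Type*} [Fintype X] [MeasurableSpace X] [DiscreteMeasurableSpace X]
    (p₀ : ℝ) (hp₀ : p₀ ∈ Set.Ioo (0 : ℝ) 1)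
    (f : State → PMF X) (hfull : ∀ θ x, f θ x ≠ 0) (hinf : f State.H ≠ f State.L)
    (c : ℝ) (hc : c ∈ Set.Ioo (0 : ℝ) 1) (δ : ℝ) (hδ : δ ∈ Set.Ioo (0 : ℝ) 1)
    (T₀ : ℕ) (ε : ℝ) (hε : 0 < ε) (hthreshold : δ ^ T₀ < (1 - δ) * (1 - c - ε)) :
    ∃ T : ℕ → ℕ, (∀ t, 2 ≤ t → T₀ ≤ T t) ∧
      ∀ σ : Fin 2 → MixedStrategy X, IsRestrictedEquilibrium p₀ f c δ T ε σ →
        ∀ (n : ℕ) (a : ActionHistory n), IsInvestment T a →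
          outcomeLaw p₀ f σ (historyEvent X a) ≠ 0 →
            ∀ i : Fin 2, 1 - ε ^ 2 < expectedBeliefH p₀ f σ i a := by
  have hδ' : 0 < 1 - δ := by linarith [hδ.2]
  -- The threshold inequality makes `(1 - δ) * (1 - c - ε)` positive, hence investing against an
  -- opponent who invests with probability `1 - ε` profitable under `H`.
  have hcε : 0 < 1 - ε - c := by
    have h := (pow_pos hδ.1 T₀).trans hthreshold
    have := pos_of_mul_pos_right h hδ'.le
    linarith
  set β := ∑ x, hell f x with hβ
  have hβ0 : 0 ≤ β := Finset.sum_nonneg fun x _ => hell_nonneg f x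
  have hβ1 : β < 1 := sum_hell_lt_one hinf
  -- Chosen so that `(1 - κ) ^ 2 ≥ 1 - 2 * κ = β`, as `Doubt.invest` requires.
  set κ := (1 - β) / 2 with hκ
  have hκ0 : 0 < κ := by rw [hκ]; linarith
  have hκ1 : κ ≤ 1 := by rw [hκ]; linarith
  have hκβ : β ≤ (1 - κ) ^ 2 := by nlinarith [sq_nonneg κ]
  set z := (1 - δ) * (1 - ε - c) / 2 with hz
  have hz0 : 0 < z := by positivity
  -- The first bound makes unconfident signals rare enough for `investProb_ge`; the second gives the
  -- conclusion, with the half providing strictness.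
  set η := min (√z * (κ / 2)) (ε ^ 2 / 2) with hη
  have hη0 : 0 < η := lt_min (mul_pos (Real.sqrt_pos.2 hz0) (by linarith)) (by positivity)
  -- Besides `T₀ ≤ N`, a long cool-off phase must make the continuation value negligible at length
  -- `t - 1` and bring the crude doubt at length `t` below `η`. The last condition is needed only
  -- for the initial phase, at `t = 1`, but is imposed for all `t` for uniformity.
  have hexists : ∀ t : ℕ, ∃ N : ℕ, T₀ ≤ N ∧
      δ ^ N * (p₀ + (1 - p₀) * (ratioBound f ^ t * ratioBound f ^ t)) ≤ z * p₀ * (κ / 2) ∧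
      crudeDoubt p₀ f t * β ^ N ≤ η ∧ crudeDoubt p₀ f 0 * β ^ N ≤ η := by
    intro t
    have h1 : Filter.Tendsto (fun N : ℕ => δ ^ N *
        (p₀ + (1 - p₀) * (ratioBound f ^ t * ratioBound f ^ t))) Filter.atTop (nhds 0) := by
      simpa using (tendsto_pow_atTop_nhds_zero_of_lt_one hδ.1.le hδ.2).mul_const
        (p₀ + (1 - p₀) * (ratioBound f ^ t * ratioBound f ^ t))
    have h2 : ∀ m, Filter.Tendsto (fun N : ℕ => crudeDoubt p₀ f m * β ^ N) Filter.atTop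
        (nhds 0) := fun m => by
      simpa using (tendsto_pow_atTop_nhds_zero_of_lt_one hβ0 hβ1).const_mul (crudeDoubt p₀ f m)
    have hpos : 0 < z * p₀ * (κ / 2) := mul_pos (mul_pos hz0 hp₀.1) (by linarith)
    obtain ⟨N, h⟩ := ((Filter.eventually_ge_atTop T₀).and ((h1.eventually_le_const hpos).and
      (((h2 t).eventually_le_const hη0).and ((h2 0).eventually_le_const hη0)))).exists
    exact ⟨N, h⟩
  choose T hT0 hT1 hT2 hT3 using hexists
  refine ⟨T, fun t _ => hT0 t, fun σ hσ n a hinv hreach i => ?_⟩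
  obtain ⟨j, hij⟩ := exists_ne i
  have hpos := fun k => reach_pos_of_outcomeLaw_ne_zero hp₀ hfull σ a hreach k State.H
  have hd := (doubt_le_of_reach_pos hp₀ hfull hc hδ hε hcε hσ hη0.le hκ0.le hκ1 hκβ
    (min_le_left _ _) (fun n => hT1 (n + 1)) (fun n => hT2 (n + 1)) (hT3 1) n a hpos).2.2 hinv
    i j hij.symm
  have hb := expectedBeliefH_ge hp₀ σ hij.symm a hpos hd
  have hε2 : η ≤ ε ^ 2 / 2 := min_le_right _ _
  have : 0 < ε ^ 2 := by positivity
  linarith
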